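/- **Setting.** For each security parameter $k\in\mathbb N$ let primes $p,q$ with $\gcd(pq,(p-1)(q-1))=1$ be drawn at random (the theorem holds for every distribution of the pair $(p,q)$, in particular for independently selected primes), where $p,q\ge 2^k$ and the bit lengths of $p,q$ are at most a fixed polynomial in $k$. Let $N=pq$ be the public key. Paillier encryption of $t$ is $E(t;r)=(N+1)^t r^N \bmod N^2$ with $r$ uniform in $\mathbb Z_N^*$. "Polynomial time" means probabilistic algorithms that, on every input and for all coin tosses, halt within a polynomial in $k$ plus the bit length of the input. A function $f:\mathbb N\to\mathbb R_{\ge 0}$ is *negligible* if for every $c\in\mathbb N$ there is $n_c$ with $f(n)\le 1/n^c$ for all $n\ge n_c$. **Decisional Composite Residuosity Assumption.** For every probabilistic polynomial-time algorithm $\mathcal D$, the function $$k\mapsto\bigl|\mathbb P\{\mathcal D(k,N,y^N \bmod N^2)=1\}-\mathbb P\{\mathcal D(k,N,y)=1\}\bigr|$$ is negligible, where $N$ is generated as above and $y$ is uniform in $\mathbb Z_{N^2}^*$. **Security experiment.** Fix $n\in\mathbb N$ and $\mathcal W=\{1,\dots,n\}$. A responder (a pair of probabilistic polynomial-time algorithms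 that share a state) receives $k$ and $N$ and proposes distinct $w_1,w_2\in\mathcal W$. Then $w$ is chosen from $\{w_1,w_2\}$ with equal probability, and the responder receives $x=(x_i)_{i\in\mathcal W}$ with $x_w=E(1;r_w)$ and $x_i=E(0;r_i)$ for $i\ne w$, where the $r_i$ are independent and uniform in $\mathbb Z_N^*$. It outputs a guess $w'\in\{w_1,w_2\}$. Its advantage is $\mathrm{Adv}(k)=|\mathbb P\{w=w'\}-1/2|$. **Proposition.** Under the Decisional Composite Residuosity Assumption, $\mathrm{Adv}$ is negligible for every such responder. -/

import Mathlib

/-! ### Randomized programs with a running time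

The machine model is the random access machine under the logarithmic cost criterion, with
structured control flow: finitely many registers hold natural numbers, arithmetic is charged by
the bit lengths of the operands, and one instruction tosses a fair coin. Registers are unbounded
integers, so that a tape or an array is stored in a register through division and remainder;
the model is polynomially equivalent to probabilistic Turing machines. -/

/-- The contents of the registers. -/
abbrev Store : Type := ℕ → ℕ

/-- The arithmetic instructions of the machine. -/
inductive ArithOp : Type
  | add
  | sub
  | mul
  | div
  | mod

/-- The result of an arithmetic instruction (subtraction is truncated at zero). -/
def ArithOp.apply : ArithOp → ℕ → ℕ → ℕ
  | .add, a, b => a + b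
  | .sub, a, b => a - b
  | .mul, a, b => a * b
  | .div, a, b => a / b
  | .mod, a, b => a % b

/-- Programs. -/
inductive Prog : Type
  /-- store the constant `c` in register `x` -/
  | const (x c : ℕ) : Prog
  /-- store the result of `o`, applied to registers `y` and `z`, in register `x` -/
  | arith (o : ArithOp) (x y z : ℕ) : Prog
  /-- store a fair random bit in register `x` -/
  | coin (x : ℕ) : Prog
  /-- run one program and then the other -/
  | seq (c d : Prog) : Prog
  /-- run `c` if register `x` is nonzero, and `d` otherwise -/
  | ite (x : ℕ) (c d : Prog) : Prog
  /-- run `c` again and again as long as register `x` is nonzero -/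
  | loop (x : ℕ) (c : Prog) : Prog

noncomputable section

/-- The outcome of a computation: `none` if the fuel ran out, and otherwise the final contents of
the registers with the time that was used. -/
abbrev Outcome : Type := Option (Store × ℕ)

/-- Continue a computation with `f`; the times add up. -/
def PMF.andThen (p : PMF Outcome) (f : Store → PMF Outcome) : PMF Outcome :=
  p.bind fun o => match o with
    | none => PMF.pure none
    | some (s, t) => (f s).map (Option.map fun r => (r.1, t + r.2))

/-- A loop with at most `n` tests of its condition; every test costs one time unit. -/
def runLoop (x : ℕ) (body : Store → PMF Outcome) : ℕ → Store → PMF Outcome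
  | 0, _ => PMF.pure none
  | n + 1, s =>
    if s x = 0 then PMF.pure (some (s, 1))
    else ((PMF.pure (some (s, 1))).andThen body).andThen (runLoop x body n)

/-- The distribution of the outcome of a program that is started with registers `s`; `fuel` bounds
the number of tests in each execution of a loop. -/
def Prog.run (fuel : ℕ) : Prog → Store → PMF Outcome
  | .const x c, s => PMF.pure (some (Function.update s x c, c.size + 1))
  | .arith o x y z, s =>
    PMF.pure (some (Function.update s x (o.apply (s y) (s z)), ((s y).size + 1) * ((s z).size + 1)))
  | .coin x, s =>
    (PMF.uniformOfFintype Bool).map fun b => some (Function.update s x b.toNat, 1)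
  | .seq c d, s => (c.run fuel s).andThen (d.run fuel)
  | .ite x c d, s =>
    (PMF.pure (some (s, 1))).andThen (if s x ≠ 0 then c.run fuel else d.run fuel)
  | .loop x c, s => runLoop x (c.run fuel) fuel s

/-- The initial registers: the security parameter `k`, the inputs, and zeros. -/
def loadStore {a : ℕ} (k : ℕ) (v : Fin a → ℕ) : Store
  | 0 => k
  | i + 1 => if h : i < a then v ⟨i, h⟩ else 0

/-- The length of the input, where the security parameter `k` counts as if it were in unary. -/
def inputLength {a : ℕ} (k : ℕ) (v : Fin a → ℕ) : ℕ :=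
  k + ∑ i, ((v i).size + 1)

/-- Probabilistic polynomial-time algorithms with `a` inputs besides the security parameter:
on every input and for every outcome of the coins, the program halts within a number of time units
that is bounded by a polynomial in the length of the input. Since each test of a loop costs a time
unit, fuel equal to the time bound does not restrict the program. -/
structure PPT (a : ℕ) where
  /-- the program -/
  prog : Prog
  /-- the bound on the running time -/
  bound : Polynomial ℕ
  /-- the program halts in time -/
  halts : ∀ (k : ℕ) (v : Fin a → ℕ),
    ∀ o ∈ (prog.run (bound.eval (inputLength k v)) (loadStore k v)).support,
      ∃ (s : Store) (t : ℕ), o = some (s, t) ∧ t ≤ bound.eval (inputLength k v)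

/-- The distribution of the final registers (the default value is never taken). -/
def PPT.exec {a : ℕ} (A : PPT a) (k : ℕ) (v : Fin a → ℕ) : PMF Store :=
  (A.prog.run (A.bound.eval (inputLength k v)) (loadStore k v)).map fun o =>
    (o.map Prod.fst).getD fun _ => 0

/-! ### Paillier encryption -/

/-- The secret primes of the encryption scheme. -/
structure PaillierKey where
  /-- the first prime -/
  p : ℕ
  /-- the second prime -/
  q : ℕ
  prime_p : p.Prime
  prime_q : q.Prime
  gcd_eq_one : Nat.gcd (p * q) ((p - 1) * (q - 1)) = 1

/-- The public key `N = p q`. -/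
def PaillierKey.N (K : PaillierKey) : ℕ := K.p * K.q

theorem PaillierKey.N_ne_zero (K : PaillierKey) : K.N ≠ 0 :=
  Nat.mul_ne_zero K.prime_p.ne_zero K.prime_q.ne_zero

/-- `ℤ_M^*`, the residues in `{0, …, M - 1}` that are coprime to `M`. -/
def unitResidues (M : ℕ) : Finset ℕ := (Finset.range M).filter fun x => Nat.Coprime x M

theorem unitResidues_nonempty {M : ℕ} (hM : M ≠ 0) : (unitResidues M).Nonempty := by
  refine ⟨1 % M, ?_⟩
  simp only [unitResidues, Finset.mem_filter, Finset.mem_range]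
  refine ⟨Nat.mod_lt _ (Nat.pos_of_ne_zero hM), ?_⟩
  have h := Nat.gcd_rec M 1
  rw [Nat.gcd_one_right] at h
  exact h.symm

/-- The encryption `E(t; r) = (N + 1) ^ t * r ^ N mod N ^ 2` of `t` with randomness `r`. -/
def paillierEncrypt (N t r : ℕ) : ℕ := ((N + 1) ^ t * r ^ N) % N ^ 2

/-- Key generation: for every security parameter `k` a distribution of the two primes, which have
more than `k` bits, and a number of bits that is polynomially bounded in `k`. -/
structure KeyGen where
  /-- the distribution of the key for a given security parameter -/
  dist : ℕ → PMF PaillierKey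
  /-- the bound on the bit lengths -/
  bits : Polynomial ℕ
  large : ∀ k, ∀ K ∈ (dist k).support, 2 ^ k ≤ K.p ∧ 2 ^ k ≤ K.q
  bounded : ∀ k, ∀ K ∈ (dist k).support, K.p.size ≤ bits.eval k ∧ K.q.size ≤ bits.eval k

/-! ### Negligible functions and the two security notions -/

/-- A function is negligible if it is eventually below every inverse polynomial. -/
def Negligible (f : ℕ → ℝ) : Prop :=
  ∀ c : ℕ, ∃ n₀ : ℕ, ∀ n : ℕ, n₀ ≤ n → f n ≤ 1 / (n : ℝ) ^ c

/-- A uniformly distributed element of `ℤ_{N²}^*`. -/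
def randomUnit (K : PaillierKey) : PMF ℕ :=
  PMF.uniformOfFinset (unitResidues (K.N ^ 2)) (unitResidues_nonempty (pow_ne_zero 2 K.N_ne_zero))

/-- A uniformly distributed `N`-th residue in `ℤ_{N²}^*`. -/
def randomResidue (K : PaillierKey) : PMF ℕ :=
  (randomUnit K).map fun y => y ^ K.N % K.N ^ 2

/-- The probability that the distinguisher `D` accepts (leaves `1` in register `0`) on the public
key and an element that is drawn from `X`. -/
def acceptProb (G : KeyGen) (X : PaillierKey → PMF ℕ) (D : PPT 2) (k : ℕ) : ℝ :=
  (((G.dist k).bind fun K => (X K).bind fun x => (D.exec k ![K.N, x]).map fun s =>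
    decide (s 0 = 1)) true).toReal

/-- The Decisional Composite Residuosity Assumption: no probabilistic polynomial-time algorithm
can tell a random `N`-th residue modulo `N²` from a random element of `ℤ_{N²}^*` with more than
negligible advantage. -/
def DecisionalCompositeResiduosity (G : KeyGen) : Prop :=
  ∀ D : PPT 2, Negligible fun k =>
    |acceptProb G randomResidue D k - acceptProb G randomUnit D k|

/-- The query for `w` over the index set `{1, …, n}`: the vector whose entry at `w` is a fresh
encryption of `1` and whose other entries are fresh encryptions of `0`. (A uniform element of the
product `(ℤ_N^*)^n` has independent uniform entries; the index `i : Fin n` stands for `i + 1`.) -/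
def submitQuery (n : ℕ) (K : PaillierKey) (w : ℕ) : PMF (Fin n → ℕ) :=
  (PMF.uniformOfFinset (Fintype.piFinset fun _ : Fin n => unitResidues K.N)
    (Fintype.piFinset_nonempty.2 fun _ => unitResidues_nonempty K.N_ne_zero)).map
    fun r i => paillierEncrypt K.N (if (i : ℕ) + 1 = w then 1 else 0) (r i)

/-- An adversary (the responder): `propose` receives the public key and leaves `w₁`, `w₂` and a
state in registers `0`, `1` and `2`; `guess` receives the public key, the state and the query, and
leaves `0` in register `0` for the guess `w₁` and any other number for the guess `w₂`. -/
structure Responder (n : ℕ) where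
  /-- the first phase -/
  propose : PPT 1
  /-- the second phase -/
  guess : PPT (n + 2)

/-- The responder always proposes two different elements of `{1, …, n}`. -/
def Responder.Admissible {n : ℕ} (A : Responder n) (G : KeyGen) : Prop :=
  ∀ k, ∀ K ∈ (G.dist k).support, ∀ s ∈ (A.propose.exec k ![K.N]).support,
    s 0 ∈ Finset.Icc 1 n ∧ s 1 ∈ Finset.Icc 1 n ∧ s 0 ≠ s 1

/-- The security experiment; its value says whether the guess `w'` equals `w`. -/
def guessExperiment {n : ℕ} (G : KeyGen) (A : Responder n) (k : ℕ) : PMF Bool :=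
  (G.dist k).bind fun K =>
  (A.propose.exec k ![K.N]).bind fun s =>
  (PMF.uniformOfFintype Bool).bind fun b =>
  let w := if b then s 1 else s 0
  (submitQuery n K w).bind fun x =>
  (A.guess.exec k (Matrix.vecCons K.N (Matrix.vecCons (s 2) x))).map fun s' =>
  let w' := if s' 0 = 0 then s 0 else s 1
  decide (w' = w)

/-- The advantage `|ℙ(w = w') - 1/2|`. -/
def advantage {n : ℕ} (G : KeyGen) (A : Responder n) (k : ℕ) : ℝ :=
  |(guessExperiment G A k true).toReal - 1 / 2|

/-- The query procedure over `{1, …, n}` is secure and private: every probabilistic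
polynomial-time responder has a negligible advantage. -/
def QuerySecure (n : ℕ) (G : KeyGen) : Prop :=
  ∀ A : Responder n, A.Admissible G → Negligible (advantage G A)

end

/-!
Given a responder, the distinguisher on `(N, y)` lets it propose `w₁` and `w₂`, tosses coins for
`w ∈ {w₁, w₂}` and `c ∈ {0, 1}`, hides `(N + 1) ^ c * y` at the index `w` among fresh encryptions
of `0`, and accepts if and only if "the guess is correct" agrees with `c`. If `y` is a uniform
unit, so is `(N + 1) * y`; the query does not depend on `c`, and the verdict is a fair coin. If `y`
is a uniform `N`-th residue, then `c = 1` gives exactly the security experiment, while for `c = 0`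
the query does not depend on `w` and the verdict is again a fair coin. Hence, up to the error
below, the distinguisher has half the advantage of the responder.

A program only tosses coins, so the distinguisher cannot sample `ℤ_N^*` exactly within its time
bound. It takes the randomness of the encryptions of `0` to be `m` random bits modulo `N`, where
`m` is the bit length of `N ^ 2`; as `p, q ≥ 2 ^ k`, this is within statistical distance `3 / 2 ^ k`
of uniform.
-/

open Polynomial

/-! ### Outcomes of programs -/

section Outcome

theorem map_congr_of_support {α β : Type*} {p : PMF α} {f g : α → β}
    (h : ∀ a ∈ p.support, f a = g a) : p.map f = p.map g := by
  ext b
  simp only [PMF.map_apply]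
  refine tsum_congr fun a => ?_
  by_cases ha : a ∈ p.support
  · rw [h a ha]
  · simp only [(p.apply_eq_zero_iff a).2 ha, ite_self]

theorem bind_congr_of_support {α β : Type*} {p : PMF α} {f g : α → PMF β}
    (h : ∀ a ∈ p.support, f a = g a) : p.bind f = p.bind g := by
  ext b
  simp only [PMF.bind_apply]
  refine tsum_congr fun a => ?_
  by_cases ha : a ∈ p.support
  · rw [h a ha]
  · simp only [(p.apply_eq_zero_iff a).2 ha, zero_mul]

variable {p p' : PMF Outcome} {f g : Store → PMF Outcome}

theorem none_mem_support_andThen : none ∈ (p.andThen f).support ↔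
    none ∈ p.support ∨ ∃ s t, some (s, t) ∈ p.support ∧ none ∈ (f s).support := by
  simp [PMF.andThen, Option.exists, -PMF.mem_support_iff]

theorem some_mem_support_andThen {s : Store} {t : ℕ} : some (s, t) ∈ (p.andThen f).support ↔
    ∃ s₁ t₁ t₂, some (s₁, t₁) ∈ p.support ∧ some (s, t₂) ∈ (f s₁).support ∧ t₁ + t₂ = t := by
  simp [PMF.andThen, Option.exists, -PMF.mem_support_iff]

theorem andThen_congr (h : ∀ s t, some (s, t) ∈ p.support → f s = g s) :
    p.andThen f = p.andThen g := by
  refine bind_congr_of_support fun o ho => ?_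
  rcases o with _ | ⟨s, t⟩
  · rfl
  · simp only [h s t ho]

theorem andThen_eq_of_none_notMem (hn : none ∉ (p.andThen f).support)
    (hp : none ∉ p.support → p' = p) (hf : ∀ s, none ∉ (f s).support → g s = f s) :
    p'.andThen g = p.andThen f := by
  rw [none_mem_support_andThen] at hn
  push Not at hn
  rw [hp hn.1]
  exact andThen_congr fun s t hs => hf s (hn.2 s t hs)

theorem runLoop_mono {x : ℕ} {b b' : Store → PMF Outcome}
    (hb : ∀ s, none ∉ (b s).support → b' s = b s) {n m : ℕ} (hnm : n ≤ m) (s : Store)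
    (hs : none ∉ (runLoop x b n s).support) : runLoop x b' m s = runLoop x b n s := by
  induction n generalizing m s with
  | zero => simp [runLoop] at hs
  | succ n ih =>
    obtain ⟨m, rfl⟩ := Nat.exists_eq_add_of_le' (Nat.one_le_of_lt hnm)
    rw [runLoop] at hs ⊢
    rw [runLoop]
    split_ifs with h0
    · rfl
    · rw [if_neg h0] at hs
      refine andThen_eq_of_none_notMem hs (fun h₁ => ?_) fun s' => ih (by omega) s'
      exact andThen_eq_of_none_notMem h₁ (fun _ => rfl) hb

theorem Prog.run_mono (P : Prog) {n m : ℕ} (hnm : n ≤ m) (s : Store)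
    (hs : none ∉ (P.run n s).support) : P.run m s = P.run n s := by
  induction P generalizing s with
  | const | arith | coin => rfl
  | seq c d hc hd => exact andThen_eq_of_none_notMem hs (hc s) hd
  | ite x c d hc hd =>
    refine andThen_eq_of_none_notMem hs (fun _ => rfl) fun s' hs' => ?_
    split_ifs at hs' ⊢ with h0
    · exact hc s' hs'
    · exact hd s' hs'
  | loop x c hc => exact runLoop_mono hc hnm s hs

end Outcome

/-! ### Frame and growth of the registers -/

section Invariants

theorem size_add_le_max (a b : ℕ) : (a + b).size ≤ max a.size b.size + 1 := by
  rw [Nat.size_le, pow_succ]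
  have ha := a.lt_size_self.trans_le (Nat.pow_le_pow_right two_pos (le_max_left a.size b.size))
  have hb := b.lt_size_self.trans_le (Nat.pow_le_pow_right two_pos (le_max_right a.size b.size))
  omega

theorem size_mul_le_add (a b : ℕ) : (a * b).size ≤ a.size + b.size := by
  rw [Nat.size_le, pow_add]
  exact Nat.mul_lt_mul'' a.lt_size_self b.lt_size_self

theorem ArithOp.size_apply_le (o : ArithOp) (a b : ℕ) :
    (o.apply a b).size ≤ (a.size + 1) * (b.size + 1) := by
  suffices h : (o.apply a b).size ≤ a.size + b.size + 1 by
    nlinarith [Nat.zero_le (a.size * b.size)]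
  cases o with
  | add => exact (size_add_le_max a b).trans (by omega)
  | sub => exact (Nat.size_le_size (Nat.sub_le a b)).trans (by omega)
  | mul => exact (size_mul_le_add a b).trans (by omega)
  | div => exact (Nat.size_le_size (Nat.div_le_self a b)).trans (by omega)
  | mod => exact (Nat.size_le_size (Nat.mod_le a b)).trans (by omega)

/-- The registers that occur as the target of an instruction of the program. -/
def Prog.writes : Prog → Set ℕ
  | .const x _ => {x}
  | .arith _ x _ _ => {x}
  | .coin x => {x}
  | .seq c d => c.writes ∪ d.writes
  | .ite _ c d => c.writes ∪ d.writes
  | .loop _ c => c.writes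

variable {R : Store → Store → ℕ → Prop}

theorem andThen_rel (htrans : ∀ {s u v t t'}, R s u t → R u v t' → R s v (t + t'))
    {f g : Store → PMF Outcome} (hf : ∀ s s' t, some (s', t) ∈ (f s).support → R s s' t)
    (hg : ∀ s s' t, some (s', t) ∈ (g s).support → R s s' t) (s s' : Store) (t : ℕ)
    (h : some (s', t) ∈ ((f s).andThen g).support) : R s s' t := by
  obtain ⟨s₁, t₁, t₂, h₁, h₂, rfl⟩ := some_mem_support_andThen.1 h
  exact htrans (hf _ _ _ h₁) (hg _ _ _ h₂)

theorem pure_some_rel (hrefl : ∀ s, R s s 1) (s s' : Store) (t : ℕ)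
    (h : some (s', t) ∈ (PMF.pure (some (s, 1)) : PMF Outcome).support) : R s s' t := by
  obtain ⟨rfl, rfl⟩ : s' = s ∧ t = 1 := by simpa using h
  exact hrefl s'

theorem runLoop_rel (hrefl : ∀ s, R s s 1)
    (htrans : ∀ {s u v t t'}, R s u t → R u v t' → R s v (t + t')) {x : ℕ}
    {b : Store → PMF Outcome} (hb : ∀ s s' t, some (s', t) ∈ (b s).support → R s s' t) (n : ℕ)
    (s s' : Store) (t : ℕ) (h : some (s', t) ∈ (runLoop x b n s).support) : R s s' t := by
  induction n generalizing s s' t with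
  | zero => simp [runLoop] at h
  | succ n ih =>
    rw [runLoop] at h
    split_ifs at h
    · exact pure_some_rel hrefl s s' t h
    · exact andThen_rel htrans (andThen_rel htrans (pure_some_rel hrefl) hb) ih s s' t h

-- Both frame properties and size bounds are instances: a reflexive and transitive relation that
-- contains every single assignment contains every run.
theorem Prog.rel_of_mem_support {P : Prog} (hrefl : ∀ s, R s s 1)
    (htrans : ∀ {s u v t t'}, R s u t → R u v t' → R s v (t + t'))
    (hupdate : ∀ s, ∀ x ∈ P.writes, ∀ v t, v.size ≤ t → R s (Function.update s x v) t)
    (fuel : ℕ) (s s' : Store) (t : ℕ) (h : some (s', t) ∈ (P.run fuel s).support) : R s s' t := by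
  induction P generalizing s s' t with
  | const x c =>
    obtain ⟨rfl, rfl⟩ : s' = _ ∧ t = _ := by simpa [Prog.run] using h
    exact hupdate s x rfl _ _ (Nat.le_succ _)
  | arith o x y z =>
    obtain ⟨rfl, rfl⟩ : s' = _ ∧ t = _ := by simpa [Prog.run] using h
    exact hupdate s x rfl _ _ (o.size_apply_le _ _)
  | coin x =>
    obtain ⟨b, -, hb⟩ := (PMF.mem_support_map_iff _ _ _).1 h
    obtain ⟨rfl, rfl⟩ : _ = s' ∧ 1 = t := by simpa using hb
    exact hupdate s x rfl _ _ (by cases b <;> simp)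
  | seq c d hc hd =>
    exact andThen_rel htrans (hc fun s x hx => hupdate s x (.inl hx))
      (hd fun s x hx => hupdate s x (.inr hx)) s s' t h
  | ite x c d hc hd =>
    refine andThen_rel (f := fun s => PMF.pure (some (s, 1))) htrans (pure_some_rel hrefl) ?_
      s s' t h
    split_ifs
    · exact hc fun s x hx => hupdate s x (.inl hx)
    · exact hd fun s x hx => hupdate s x (.inr hx)
  | loop x c hc => exact runLoop_rel hrefl htrans (hc hupdate) fuel s s' t h

theorem Prog.frame {P : Prog} {fuel t : ℕ} {s s' : Store}
    (h : some (s', t) ∈ (P.run fuel s).support) : ∀ i ∉ P.writes, s' i = s i :=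
  P.rel_of_mem_support (R := fun s s' _ => ∀ i ∉ P.writes, s' i = s i) (fun _ _ _ => rfl)
    (fun h h' i hi => (h' i hi).trans (h i hi))
    (fun _ x hx _ _ _ i hi => Function.update_of_ne (by rintro rfl; exact hi hx) _ _) fuel s s' t h

theorem Prog.size_le_max {P : Prog} {fuel t : ℕ} {s s' : Store}
    (h : some (s', t) ∈ (P.run fuel s).support) (i : ℕ) : (s' i).size ≤ max (s i).size t := by
  refine P.rel_of_mem_support (R := fun s s' t => ∀ i, (s' i).size ≤ max (s i).size t)
    (fun _ _ => le_max_left _ _) (fun h h' i => ?_) (fun s x _ v t hv i => ?_) fuel s s' t h i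
  · have := h i
    have := h' i
    omega
  · rcases eq_or_ne i x with rfl | hi
    · rw [Function.update_self]
      exact hv.trans (le_max_right _ _)
    · rw [Function.update_of_ne hi]
      exact le_max_left _ _

end Invariants

/-! ### Renaming of registers -/

section Rename

/-- The program in which register `i` is replaced by register `φ i`: it runs as a subroutine on
its own part of the registers. -/
def Prog.rename (φ : ℕ → ℕ) : Prog → Prog
  | .const x c => .const (φ x) c
  | .arith o x y z => .arith o (φ x) (φ y) (φ z)
  | .coin x => .coin (φ x)
  | .seq c d => .seq (c.rename φ) (d.rename φ)
  | .ite x c d => .ite (φ x) (c.rename φ) (d.rename φ)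
  | .loop x c => .loop (φ x) (c.rename φ)

theorem Prog.writes_rename_subset (φ : ℕ → ℕ) (P : Prog) : (P.rename φ).writes ⊆ Set.range φ := by
  induction P with
  | const x | arith _ x | coin x => exact Set.singleton_subset_iff.2 ⟨x, rfl⟩
  | seq _ _ hc hd | ite _ _ _ hc hd => exact Set.union_subset hc hd
  | loop _ _ hc => exact hc

/-- The outcome of the renamed computation, where `u` holds the other registers. -/
noncomputable def Outcome.extend (φ : ℕ → ℕ) (u : Store) : Outcome → Outcome :=
  Option.map fun r => (Function.extend φ r.1 u, r.2)

variable {φ : ℕ → ℕ} {u : Store}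

theorem Store.extend_update (hφ : φ.Injective) (s u : Store) (x v : ℕ) :
    Function.extend φ (Function.update s x v) u =
      Function.update (Function.extend φ s u) (φ x) v := by
  funext i
  by_cases hi : ∃ j, φ j = i
  · obtain ⟨j, rfl⟩ := hi
    simp only [hφ.extend_apply, Function.update_apply, hφ.eq_iff]
  · have hx : i ≠ φ x := fun h => hi ⟨x, h.symm⟩
    rw [Function.extend_apply' _ _ _ hi, Function.update_of_ne hx, Function.extend_apply' _ _ _ hi]

theorem andThen_extend {p p' : PMF Outcome} {f g : Store → PMF Outcome}
    (hp : p' = p.map (Outcome.extend φ u))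
    (hf : ∀ s, g (Function.extend φ s u) = (f s).map (Outcome.extend φ u)) :
    p'.andThen g = (p.andThen f).map (Outcome.extend φ u) := by
  rw [hp, PMF.andThen, PMF.andThen, PMF.bind_map, PMF.map_bind]
  congr 1
  funext o
  rcases o with _ | ⟨s, t⟩
  · simp only [Outcome.extend, Function.comp_apply, Option.map_none, PMF.pure_map]
  · simp only [Function.comp_apply, Outcome.extend, Option.map_some, hf, PMF.map_comp]
    congr 1
    funext o
    cases o <;> rfl

theorem pure_some_extend (s : Store) (t : ℕ) :
    (PMF.pure (some (Function.extend φ s u, t)) : PMF Outcome) =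
      (PMF.pure (some (s, t))).map (Outcome.extend φ u) := by
  rw [PMF.pure_map, Outcome.extend, Option.map_some]

theorem runLoop_rename (hφ : φ.Injective) {x : ℕ} {b b' : Store → PMF Outcome}
    (hb : ∀ s, b' (Function.extend φ s u) = (b s).map (Outcome.extend φ u)) (n : ℕ) (s : Store) :
    runLoop (φ x) b' n (Function.extend φ s u) = (runLoop x b n s).map (Outcome.extend φ u) := by
  induction n generalizing s with
  | zero => rw [runLoop, runLoop, PMF.pure_map, Outcome.extend, Option.map_none]
  | succ n ih =>
    rw [runLoop, runLoop, hφ.extend_apply]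
    split_ifs
    · exact pure_some_extend s 1
    · exact andThen_extend (andThen_extend (pure_some_extend s 1) hb) ih

theorem Prog.run_rename (hφ : φ.Injective) (P : Prog) (fuel : ℕ) (s : Store) :
    (P.rename φ).run fuel (Function.extend φ s u) = (P.run fuel s).map (Outcome.extend φ u) := by
  induction P generalizing s with
  | const x c => rw [rename, run, ← Store.extend_update hφ, pure_some_extend, run]
  | arith o x y z =>
    rw [rename, run, hφ.extend_apply, hφ.extend_apply, ← Store.extend_update hφ, pure_some_extend,
      run]
  | coin x =>
    simp only [rename, run, PMF.map_comp, ← Store.extend_update hφ]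
    rfl
  | seq c d hc hd => exact andThen_extend (hc s) hd
  | ite x c d hc hd =>
    rw [rename, run, run, hφ.extend_apply]
    refine andThen_extend (pure_some_extend s 1) fun s' => ?_
    split_ifs
    · exact hc s'
    · exact hd s'
  | loop x c hc => exact runLoop_rename hφ hc fuel s

end Rename

/-! ### Couplings with the running time -/

section Couples

/-- The computation with outcome `r` halts within `T` time units, and it can be coupled with a
value of distribution `d` such that the value and the final registers satisfy `Q`. -/
def Couples {α : Type*} (r : PMF Outcome) (T : ℕ) (d : PMF α) (Q : α → Store → Prop) : Prop :=
  ∃ p : PMF (α × Store × ℕ), p.map Prod.fst = d ∧ p.map (fun x => some x.2) = r ∧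
    ∀ x ∈ p.support, Q x.1 x.2.1 ∧ x.2.2 ≤ T

variable {α β : Type*} {r : PMF Outcome} {T T' : ℕ} {d : PMF α} {Q Q' : α → Store → Prop}

theorem Couples.pure {a : α} {s : Store} {t : ℕ} (ht : t ≤ T) (hQ : Q a s) :
    Couples (PMF.pure (some (s, t))) T (PMF.pure a) Q := by
  refine ⟨PMF.pure (a, s, t), PMF.pure_map _ _, PMF.pure_map _ _, fun x hx => ?_⟩
  obtain rfl := (PMF.mem_support_pure_iff _ _).1 hx
  exact ⟨hQ, ht⟩

theorem Couples.mono (h : Couples r T d Q) (hT : T ≤ T') (hQ : ∀ a s, Q a s → Q' a s) :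
    Couples r T' d Q' := by
  obtain ⟨p, hd, hr, hp⟩ := h
  exact ⟨p, hd, hr, fun x hx => ⟨hQ _ _ (hp x hx).1, (hp x hx).2.trans hT⟩⟩

theorem Couples.map {R : β → Store → Prop} (h : Couples r T d Q) (f : α → β)
    (hR : ∀ a s, Q a s → R (f a) s) : Couples r T (d.map f) R := by
  obtain ⟨p, rfl, rfl, hp⟩ := h
  refine ⟨p.map fun x => (f x.1, x.2), by rw [PMF.map_comp, PMF.map_comp]; rfl,
    by rw [PMF.map_comp]; rfl, fun x hx => ?_⟩
  obtain ⟨y, hy, rfl⟩ := (PMF.mem_support_map_iff _ _ _).1 hx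
  exact ⟨hR _ _ (hp y hy).1, (hp y hy).2⟩

theorem Couples.and_of_support {R : Store → Prop} (h : Couples r T d Q)
    (hR : ∀ s t, t ≤ T → some (s, t) ∈ r.support → R s) :
    Couples r T d fun a s => Q a s ∧ R s := by
  obtain ⟨p, hd, rfl, hp⟩ := h
  refine ⟨p, hd, rfl, fun x hx => ⟨⟨(hp x hx).1, hR x.2.1 x.2.2 (hp x hx).2 ?_⟩, (hp x hx).2⟩⟩
  exact (PMF.mem_support_map_iff _ _ _).2 ⟨x, hx, rfl⟩

theorem Couples.andThen {e : α → PMF β} {R : β → Store → Prop} {f : Store → PMF Outcome}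
    (h : Couples r T d Q) (h' : ∀ a s, Q a s → Couples (f s) T' (e a) R) :
    Couples (r.andThen f) (T + T') (d.bind e) R := by
  obtain ⟨p, rfl, rfl, hp⟩ := h
  obtain ⟨x₀, hx₀⟩ := p.support_nonempty
  have : Nonempty (PMF (β × Store × ℕ)) := ⟨(h' _ _ (hp x₀ hx₀).1).choose⟩
  choose! q he hf hq using h'
  refine ⟨p.bind fun x => (q x.1 x.2.1).map fun y => (y.1, y.2.1, x.2.2 + y.2.2), ?_, ?_, ?_⟩
  · rw [PMF.map_bind, PMF.bind_map]
    refine bind_congr_of_support fun x hx => ?_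
    rw [PMF.map_comp, Function.comp_apply, ← he _ _ (hp x hx).1]
    rfl
  · rw [PMF.map_bind, PMF.andThen, PMF.bind_map]
    refine bind_congr_of_support fun x hx => ?_
    simp only [Function.comp_apply, ← hf _ _ (hp x hx).1, PMF.map_comp]
    rfl
  · intro z hz
    obtain ⟨x, hx, hz⟩ := (PMF.mem_support_bind_iff _ _ _).1 hz
    obtain ⟨y, hy, rfl⟩ := (PMF.mem_support_map_iff _ _ _).1 hz
    have hxy := hq _ _ (hp x hx).1 y hy
    exact ⟨hxy.1, Nat.add_le_add (hp x hx).2 hxy.2⟩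

theorem Couples.pure_andThen {s : Store} {t : ℕ} {f : Store → PMF Outcome}
    (h : Couples (f s) T d Q) : Couples ((PMF.pure (some (s, t))).andThen f) (t + T) d Q := by
  have hpure : Couples (PMF.pure (some (s, t))) t (PMF.pure ()) fun _ s' => s' = s :=
    .pure le_rfl rfl
  simpa only [PMF.pure_bind] using hpure.andThen (e := fun _ => d) fun _ s' hs' => hs' ▸ h

theorem Couples.rename {φ : ℕ → ℕ} (hφ : φ.Injective) {P : Prog} {fuel : ℕ} {s u : Store}
    (hu : ∀ i, u (φ i) = s i) (h : Couples (P.run fuel s) T d Q) :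
    Couples ((P.rename φ).run fuel u) T d fun a s' => Q a fun i => s' (φ i) := by
  have hext : u = Function.extend φ s u := by
    funext i
    by_cases hi : ∃ j, φ j = i
    · obtain ⟨j, rfl⟩ := hi
      rw [hφ.extend_apply, hu]
    · rw [Function.extend_apply' _ _ _ hi]
  obtain ⟨p, rfl, hr, hp⟩ := h
  refine ⟨p.map fun x => (x.1, Function.extend φ x.2.1 u, x.2.2), by rw [PMF.map_comp]; rfl, ?_,
    fun x hx => ?_⟩
  · rw [hext, P.run_rename hφ, ← hr, PMF.map_comp, PMF.map_comp, ← hext]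
    rfl
  · obtain ⟨y, hy, rfl⟩ := (PMF.mem_support_map_iff _ _ _).1 hx
    simpa only [hφ.extend_apply] using hp y hy

end Couples

section PPT

variable {a : ℕ} (A : PPT a) (k : ℕ) (v : Fin a → ℕ)

theorem PPT.couples_run {fuel : ℕ} (hf : A.bound.eval (inputLength k v) ≤ fuel) :
    Couples (A.prog.run fuel (loadStore k v)) (A.bound.eval (inputLength k v)) (A.exec k v)
      fun s s' => s' = s := by
  rw [A.prog.run_mono hf _ fun h => by obtain ⟨s, t, h, -⟩ := A.halts k v _ h; simp at h]
  set r := A.prog.run (A.bound.eval (inputLength k v)) (loadStore k v)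
  let store : Outcome → Store := fun o => (o.map Prod.fst).getD fun _ => 0
  let time : Outcome → ℕ := fun o => (o.map Prod.snd).getD 0
  refine ⟨r.map fun o => (store o, store o, time o), by rw [PMF.map_comp]; rfl, ?_, fun x hx => ?_⟩
  · rw [PMF.map_comp]
    refine (map_congr_of_support (g := id) fun o ho => ?_).trans (PMF.map_id r)
    obtain ⟨s, t, rfl, -⟩ := A.halts k v o ho
    rfl
  · obtain ⟨o, ho, rfl⟩ := (PMF.mem_support_map_iff _ _ _).1 hx
    obtain ⟨s, t, rfl, ht⟩ := A.halts k v o ho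
    exact ⟨rfl, ht⟩

theorem Couples.map_exec {α : Type*} {A : PPT a} {k T : ℕ} {v : Fin a → ℕ} {d : PMF α}
    {f : Store → α}
    (h : Couples (A.prog.run (A.bound.eval (inputLength k v)) (loadStore k v)) T d
      fun x s => f s = x) : (A.exec k v).map f = d := by
  obtain ⟨p, rfl, hr, hp⟩ := h
  rw [PPT.exec, ← hr, PMF.map_comp, PMF.map_comp]
  exact map_congr_of_support fun x hx => (hp x hx).1

end PPT

/-! ### A calculus for polynomial running times -/

section Yields

/-- All registers hold numbers of at most `S` bits. -/
def Store.SizeLE (s : Store) (S : ℕ) : Prop := ∀ i, (s i).size ≤ S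

/-- Started with registers `s`, the program `P` halts within `p.eval S` time units, where `S` bounds
`k` and the lengths of all registers, and its run can be coupled with a value of distribution `d`
such that the value and the final registers satisfy `Q`. -/
def Yields {α : Type*} (k : ℕ) (P : Prog) (s : Store) (p : ℕ[X]) (d : PMF α)
    (Q : α → Store → Prop) : Prop :=
  ∀ S, k ≤ S → s.SizeLE S → ∀ fuel, p.eval S ≤ fuel → Couples (P.run fuel s) (p.eval S) d Q

/-- The running time of a program with time bound `p` that is followed by a program with time bound
`q`, which starts with registers of length at most `S + p.eval S`. -/
noncomputable def seqTime (p q : ℕ[X]) : ℕ[X] := p + q.comp (X + p)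

/-- The running time of a loop that halves the register it tests and whose body, with time bound
`p`, lengthens the registers by at most one bit. -/
noncomputable def loopTime (p : ℕ[X]) : ℕ[X] := (X + 1) * (1 + p.comp (2 * X))

/-- A bound on the running time of a program whose loops are as in `loopTime`. -/
noncomputable def Prog.timeBound : Prog → ℕ[X]
  | .const _ c => C (c.size + 1)
  | .arith _ _ _ _ => (X + 1) ^ 2
  | .coin _ => 1
  | .seq c d => seqTime c.timeBound d.timeBound
  | .ite _ c d => 1 + (c.timeBound + d.timeBound)
  | .loop _ c => loopTime c.timeBound

theorem eval_le_eval (p : ℕ[X]) {m n : ℕ} (h : m ≤ n) : p.eval m ≤ p.eval n := by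
  rw [eval_eq_sum_range, eval_eq_sum_range]
  gcongr

variable {α β : Type*} {k : ℕ} {P P' : Prog} {s : Store} {p p' : ℕ[X]} {d : PMF α}
  {Q Q' : α → Store → Prop}

theorem Yields.mono (h : Yields k P s p d Q) (hQ : ∀ a s', Q a s' → Q' a s') :
    Yields k P s p d Q' :=
  fun S hk hS fuel hf => (h S hk hS fuel hf).mono le_rfl hQ

theorem Yields.map {R : β → Store → Prop} (h : Yields k P s p d Q) (f : α → β)
    (hR : ∀ a s', Q a s' → R (f a) s') : Yields k P s p (d.map f) R :=
  fun S hk hS fuel hf => (h S hk hS fuel hf).map f hR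

theorem Yields.frame (h : Yields k P s p d Q) :
    Yields k P s p d fun a s' => Q a s' ∧ ∀ i ∉ P.writes, s' i = s i :=
  fun S hk hS fuel hf => (h S hk hS fuel hf).and_of_support fun _ _ _ => P.frame

theorem Yields.seq {e : α → PMF β} {R : β → Store → Prop} (h : Yields k P s p d Q)
    (h' : ∀ a s', Q a s' → Yields k P' s' p' (e a) R) :
    Yields k (.seq P P') s (seqTime p p') (d.bind e) R := by
  intro S hk hS fuel hf
  simp only [seqTime, eval_add, eval_comp, eval_X] at hf ⊢
  have hsize : ∀ s' t, t ≤ p.eval S → some (s', t) ∈ (P.run fuel s).support →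
      s'.SizeLE (S + p.eval S) := fun s' t ht hs' i => (P.size_le_max hs' i).trans <| by
    have := hS i
    omega
  exact ((h S hk hS fuel (by omega)).and_of_support hsize).andThen fun a s' hs' =>
    h' a s' hs'.1 _ (by omega) hs'.2 fuel (by omega)

theorem Yields.seq_pure {Q : Unit → Store → Prop} {d : PMF β} {R : β → Store → Prop}
    (h : Yields k P s p (PMF.pure ()) Q) (h' : ∀ s', Q () s' → Yields k P' s' p' d R) :
    Yields k (.seq P P') s (seqTime p p') d R := by
  simpa only [PMF.pure_bind] using h.seq (e := fun _ => d) fun _ => h'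

theorem Yields.coin {x : ℕ} :
    Yields k (.coin x) s 1 (PMF.uniformOfFintype Bool) fun b s' =>
      s' = Function.update s x b.toNat := by
  refine fun S _ _ fuel _ => ⟨(PMF.uniformOfFintype Bool).map fun b =>
    (b, Function.update s x b.toNat, 1), ?_, ?_, fun y hy => ?_⟩
  · rw [PMF.map_comp]
    exact PMF.map_id _
  · rw [PMF.map_comp]
    rfl
  · obtain ⟨b, -, rfl⟩ := (PMF.mem_support_map_iff _ _ _).1 hy
    exact ⟨rfl, eval_one.ge⟩

end Yields

section Straight

/-- The program neither tosses a coin nor contains a loop. -/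
def Prog.isStraight : Prog → Bool
  | .const _ _ => true
  | .arith _ _ _ _ => true
  | .coin _ => false
  | .seq c d => c.isStraight && d.isStraight
  | .ite _ c d => c.isStraight && d.isStraight
  | .loop _ _ => false

/-- The final registers of a program without coins and loops. -/
def Prog.result : Prog → Store → Store
  | .const x c, s => Function.update s x c
  | .arith o x y z, s => Function.update s x (o.apply (s y) (s z))
  | .coin _, s => s
  | .seq c d, s => d.result (c.result s)
  | .ite x c d, s => fun i => if s x = 0 then d.result s i else c.result s i
  | .loop _ _, s => s

variable {α : Type*} {k : ℕ} {P P' : Prog} {s : Store} {p : ℕ[X]} {d : PMF α}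
  {Q R : α → Store → Prop}

theorem Yields.straight (hP : P.isStraight) {a : α} (h : Q a (P.result s)) :
    Yields k P s P.timeBound (PMF.pure a) Q := by
  suffices hr : Yields k P s P.timeBound (PMF.pure ()) fun _ s' => s' = P.result s by
    simpa only [PMF.pure_map] using hr.map (fun _ => a) fun _ s' hs' => hs' ▸ h
  clear h
  induction P generalizing s with
  | const x c => exact fun S _ _ _ _ => .pure (by simp only [Prog.timeBound, eval_C, le_refl]) rfl
  | arith o x y z =>
    refine fun S _ hS _ _ => .pure ?_ rfl
    simp only [Prog.timeBound, eval_pow, eval_add, eval_X, eval_one]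
    rw [pow_two]
    exact Nat.mul_le_mul (Nat.succ_le_succ (hS y)) (Nat.succ_le_succ (hS z))
  | coin | loop => cases hP
  | seq c d hc hd =>
    obtain ⟨h₁, h₂⟩ := Bool.and_eq_true_iff.1 hP
    exact (hc h₁).seq_pure fun s' hs' => hs' ▸ hd h₂
  | ite x c d hc hd =>
    obtain ⟨h₁, h₂⟩ := Bool.and_eq_true_iff.1 hP
    intro S hk hS fuel hf
    simp only [Prog.timeBound, eval_add, eval_one] at hf ⊢
    refine .mono (.pure_andThen ?_) le_rfl fun _ _ h => h
    by_cases hx : s x = 0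
    · simp only [Prog.result, if_pos hx, if_neg (not_not_intro hx)]
      exact (hd h₂ S hk hS fuel (by omega)).mono (by omega) fun _ _ h => h
    · simp only [Prog.result, ne_eq, hx, not_false_eq_true, if_true]
      exact (hc h₁ S hk hS fuel (by omega)).mono (by omega) fun _ _ h => h

theorem Yields.straight_seq (hP : P.isStraight) (h : Yields k P' (P.result s) p d Q) :
    Yields k (.seq P P') s (seqTime P.timeBound p) d Q :=
  (Yields.straight (Q := fun _ s' => s' = P.result s) hP rfl).seq_pure fun _ hs' => hs' ▸ h

theorem Yields.seq_straight (h : Yields k P s p d Q) (hP' : P'.isStraight)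
    (hR : ∀ a s', Q a s' → R a (P'.result s')) :
    Yields k (.seq P P') s (seqTime p P'.timeBound) d R := by
  simpa only [PMF.bind_pure] using h.seq fun a s' hs' => Yields.straight hP' (hR a s' hs')

end Straight

section Loop

variable {α : Type*}

/-- The distribution of the value after `m` random steps. -/
noncomputable def iterBind (step : α → PMF α) : ℕ → α → PMF α
  | 0, a => PMF.pure a
  | m + 1, a => (step a).bind (iterBind step m)

theorem iterBind_pure (m : ℕ) (a : α) : iterBind PMF.pure m a = PMF.pure a := by
  induction m with
  | zero => rfl
  | succ m ih => rw [iterBind, PMF.pure_bind, ih]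

theorem size_div_two (n : ℕ) : (n / 2).size = n.size - 1 := by
  rcases eq_or_ne n 0 with rfl | hn
  · rfl
  · have hbit : Nat.bit n.bodd (n / 2) = n := by rw [← Nat.div2_val, Nat.bit_bodd_div2]
    conv_rhs => rw [← hbit]
    rw [Nat.size_bit (by rwa [hbit]), Nat.succ_sub_one]

variable {k x : ℕ} {P : Prog} {p : ℕ[X]} {Inv : α → Store → Prop} {step : α → PMF α}

theorem couples_runLoop (hbody : ∀ a s, Inv a s → s x ≠ 0 → Yields k P s p (step a) fun a' s' =>
      Inv a' s' ∧ s' x = s x / 2 ∧ ∀ S, s.SizeLE S → s'.SizeLE (S + 1))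
    {S' fuel : ℕ} (hk : k ≤ S') (hfuel : p.eval S' ≤ fuel) {m n : ℕ} {a : α} {s : Store} {S : ℕ}
    (ha : Inv a s) (hm : (s x).size = m) (hs : s.SizeLE S) (hS : S + m ≤ S') (hn : m + 1 ≤ n) :
    Couples (runLoop x (P.run fuel) n s) (1 + m * (1 + p.eval S')) (iterBind step m a)
      fun a' s' => Inv a' s' ∧ s' x = 0 := by
  induction m generalizing n a s S with
  | zero =>
    obtain ⟨n, rfl⟩ := Nat.exists_eq_add_of_le' hn
    have hx : s x = 0 := Nat.size_eq_zero.1 hm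
    rw [runLoop, if_pos hx]
    exact .pure (by omega) ⟨ha, hx⟩
  | succ m ih =>
    obtain ⟨n, rfl⟩ := Nat.exists_eq_add_of_le' (Nat.one_le_of_lt hn)
    have hx : s x ≠ 0 := fun h => by simp [h] at hm
    have hs' : s.SizeLE S' := fun i => (hs i).trans (by omega)
    rw [runLoop, if_neg hx]
    have hrun := (hbody a s ha hx S' hk hs' fuel hfuel).pure_andThen (s := s) (t := 1)
    refine (hrun.andThen fun a' s' hs' => ih hs'.1 ?_ (hs'.2.2 S hs) (by omega) (by omega)).mono
      (by ring_nf; rfl) fun _ _ h => h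
    rw [hs'.2.1, size_div_two, hm, Nat.add_sub_cancel]

theorem Yields.loop (hbody : ∀ a s, Inv a s → s x ≠ 0 → Yields k P s p (step a) fun a' s' =>
      Inv a' s' ∧ s' x = s x / 2 ∧ ∀ S, s.SizeLE S → s'.SizeLE (S + 1))
    {a : α} {s : Store} (ha : Inv a s) :
    Yields k (.loop x P) s (loopTime p) (iterBind step (s x).size a)
      fun a' s' => Inv a' s' ∧ s' x = 0 := by
  intro S hk hs fuel hf
  have hx := hs x
  have htime : (loopTime p).eval S = (S + 1) * (1 + p.eval (2 * S)) := by
    simp only [loopTime, eval_add, eval_mul, eval_comp, eval_one, eval_X, eval_ofNat]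
  rw [htime] at hf ⊢
  refine (couples_runLoop hbody (S' := 2 * S) (by omega) (by nlinarith) ha rfl hs (by omega)
    (by nlinarith)).mono ?_ fun _ _ h => h
  nlinarith [Nat.mul_le_mul_right (1 + p.eval (2 * S)) hx]

end Loop

section Call

variable {a : ℕ}

/-- A bound on the running time of a call of `A` as a subroutine, in terms of a bound on `k` and on
the lengths of all registers. -/
noncomputable def PPT.callTime (A : PPT a) : ℕ[X] := A.bound.comp ((C a + 1) * (X + 1))

theorem Yields.call (A : PPT a) {φ : ℕ → ℕ} (hφ : φ.Injective) {k : ℕ} {v : Fin a → ℕ}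
    {s : Store} (hs : ∀ i, s (φ i) = loadStore k v i) :
    Yields k (A.prog.rename φ) s A.callTime (A.exec k v)
      fun r s' => (∀ i, s' (φ i) = r i) ∧ ∀ i ∉ Set.range φ, s' i = s i := by
  have hcall : Yields k (A.prog.rename φ) s A.callTime (A.exec k v)
      fun r s' => ∀ i, s' (φ i) = r i := by
    intro S hk hS fuel hf
    have hlen : inputLength k v ≤ (a + 1) * (S + 1) := by
      have hv : ∑ i, ((v i).size + 1) ≤ ∑ _i : Fin a, (S + 1) := by
        refine Finset.sum_le_sum fun i _ => Nat.succ_le_succ ?_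
        have hi := hS (φ (i + 1))
        rwa [hs, loadStore, dif_pos i.isLt] at hi
      rw [Finset.sum_const, Finset.card_univ, Fintype.card_fin, smul_eq_mul] at hv
      rw [inputLength]
      linarith
    have htime : A.bound.eval (inputLength k v) ≤ A.callTime.eval S := by
      simpa only [PPT.callTime, eval_comp, eval_mul, eval_add, eval_C, eval_X, eval_one]
        using eval_le_eval A.bound hlen
    exact ((A.couples_run k v (htime.trans hf)).rename hφ hs).mono htime fun r s' h =>
      congrFun h
  exact hcall.frame.mono fun r s' h =>
    ⟨h.1, fun i hi => h.2 i fun hw => hi (A.prog.writes_rename_subset φ hw)⟩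

end Call

section OfYields

variable {a : ℕ} {α : Type*} {P : Prog} {p : ℕ[X]} {d : ℕ → (Fin a → ℕ) → PMF α}
  {Q : ℕ → (Fin a → ℕ) → α → Store → Prop}

theorem loadStore_sizeLE (k : ℕ) (v : Fin a → ℕ) :
    (loadStore k v).SizeLE (inputLength k v) := by
  rintro (_ | i)
  · exact (Nat.size_le.2 k.lt_two_pow_self).trans (Nat.le_add_right _ _)
  · rw [loadStore]
    split_ifs with hi
    · have hle := Finset.single_le_sum (f := fun i => (v i).size + 1) (fun _ _ => Nat.zero_le _)
        (Finset.mem_univ ⟨i, hi⟩)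
      rw [inputLength]
      omega
    · exact Nat.zero_le _

theorem couples_of_yields (h : ∀ k v, Yields k P (loadStore k v) p (d k v) (Q k v)) (k : ℕ)
    (v : Fin a → ℕ) :
    Couples (P.run (p.eval (inputLength k v)) (loadStore k v)) (p.eval (inputLength k v)) (d k v)
      (Q k v) :=
  h k v _ (Nat.le_add_right _ _) (loadStore_sizeLE k v) _ le_rfl

/-- The algorithm with program `P` and time bound `p`. -/
def PPT.ofYields (h : ∀ k v, Yields k P (loadStore k v) p (d k v) (Q k v)) : PPT a where
  prog := P
  bound := p
  halts k v o ho := by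
    obtain ⟨q, -, hq, hT⟩ := couples_of_yields h k v
    rw [← hq] at ho
    obtain ⟨x, hx, rfl⟩ := (PMF.mem_support_map_iff _ _ _).1 ho
    exact ⟨x.2.1, x.2.2, rfl, (hT x hx).2⟩

theorem PPT.map_exec_ofYields (h : ∀ k v, Yields k P (loadStore k v) p (d k v) (Q k v))
    {f : Store → α} (hf : ∀ k v x s, Q k v x s → f s = x) (k : ℕ) (v : Fin a → ℕ) :
    ((PPT.ofYields h).exec k v).map f = d k v :=
  Couples.map_exec ((couples_of_yields h k v).mono le_rfl (hf k v))

end OfYields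

/-! ### Programs for encryptions of zero -/

infixr:60 ";;" => Prog.seq

-- The registers from `16` on are left to the two phases of the responder.
namespace Reg

@[simp] abbrev secParam : ℕ := 0
@[simp] abbrev verdict : ℕ := 0
@[simp] abbrev key : ℕ := 1
@[simp] abbrev challenge : ℕ := 2
@[simp] abbrev indexCoin : ℕ := 3
@[simp] abbrev plainCoin : ℕ := 4
@[simp] abbrev index : ℕ := 5
@[simp] abbrev entry : ℕ := 6
@[simp] abbrev modulus : ℕ := 7
@[simp] abbrev zero : ℕ := 8
@[simp] abbrev one : ℕ := 9
@[simp] abbrev two : ℕ := 10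
@[simp] abbrev counter : ℕ := 11
@[simp] abbrev base : ℕ := 12
@[simp] abbrev acc : ℕ := 13
@[simp] abbrev flag : ℕ := 14
@[simp] abbrev scratch : ℕ := 15
@[simp] abbrev propose (i : ℕ) : ℕ := 2 * i + 16
@[simp] abbrev guess (i : ℕ) : ℕ := 2 * i + 17

end Reg

section SizeLE

variable {s : Store} {S : ℕ}

theorem Store.SizeLE.update (hs : s.SizeLE S) (x : ℕ) {v : ℕ} (hv : v.size ≤ S) :
    Store.SizeLE (Function.update s x v) S := by
  intro i
  rw [Function.update_apply]
  split_ifs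
  · exact hv
  · exact hs i

theorem Store.SizeLE.succ (hs : s.SizeLE S) : s.SizeLE (S + 1) := fun i => (hs i).trans S.le_succ

end SizeLE

section RandomBits

/-- The number whose binary digits are those of `a`, followed by `m` random bits. -/
noncomputable def randomBits (m a : ℕ) : PMF ℕ :=
  iterBind (fun a => (PMF.uniformOfFintype Bool).map fun b => 2 * a + b.toNat) m a

def bitStep : Prog :=
  .arith .div Reg.counter Reg.counter Reg.two ;;
  .coin Reg.flag ;;
  .arith .add Reg.base Reg.base Reg.base ;;
  .arith .add Reg.base Reg.base Reg.flag

/-- Leaves a random number in `base`; the halvings of `key ^ 2` in `counter` count its bits. -/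
def randomBitsProg : Prog :=
  .arith .mul Reg.counter Reg.key Reg.key ;;
  .const Reg.base 0 ;;
  .loop Reg.counter bitStep

variable {k : ℕ} {s : Store}

theorem yields_bitStep {a : ℕ} (htwo : s Reg.two = 2) (hbase : s Reg.base = a) :
    Yields k bitStep s bitStep.timeBound
      ((PMF.uniformOfFintype Bool).map fun b => 2 * a + b.toNat) fun a' s' =>
        (s' Reg.two = 2 ∧ s' Reg.base = a') ∧ s' Reg.counter = s Reg.counter / 2 ∧
          ∀ S, s.SizeLE S → s'.SizeLE (S + 1) := by
  have hbit : Yields k bitStep s bitStep.timeBound (PMF.uniformOfFintype Bool) fun b s' =>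
      s' = Function.update (Function.update (Function.update s Reg.counter (s Reg.counter / 2))
        Reg.flag b.toNat) Reg.base (2 * a + b.toNat) := by
    refine .straight_seq rfl (Yields.coin.seq_straight rfl fun b s' hs' => ?_)
    simp [Prog.result, ArithOp.apply, hs', hbase, htwo, two_mul]
  refine hbit.map _ fun b s' hs' => ?_
  subst hs'
  refine ⟨⟨by simpa using htwo, by simp⟩, by simp, fun S hS => ?_⟩
  refine .update (.update (.update hS.succ _ ((Nat.size_le_size (Nat.div_le_self _ _)).trans
    (hS.succ _))) _ (by cases b <;> simp)) _ ?_
  have ha := hS Reg.base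
  rw [hbase, Nat.size_le] at ha
  rw [Nat.size_le, pow_succ]
  have hb := b.toNat_le
  omega

theorem yields_randomBitsProg (htwo : s Reg.two = 2) :
    Yields k randomBitsProg s randomBitsProg.timeBound
      (randomBits (s Reg.key * s Reg.key).size 0) fun a s' => s' Reg.base = a := by
  refine .straight_seq rfl (.straight_seq rfl ?_)
  refine .mono (.loop (Inv := fun a s => s Reg.two = 2 ∧ s Reg.base = a)
    (fun a s h _ => yields_bitStep h.1 h.2) ⟨?_, ?_⟩) fun a s' h => h.1.2
  · simpa [Prog.result] using htwo
  · simp [Prog.result]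

end RandomBits

section Power

def powStep : Prog :=
  .arith .mod Reg.flag Reg.counter Reg.two ;;
  .ite Reg.flag (.arith .mul Reg.acc Reg.acc Reg.base) (.const Reg.flag 0) ;;
  .arith .mod Reg.acc Reg.acc Reg.modulus ;;
  .arith .mul Reg.base Reg.base Reg.base ;;
  .arith .mod Reg.base Reg.base Reg.modulus ;;
  .arith .div Reg.counter Reg.counter Reg.two

/-- Copy register `y` to register `x`. -/
def copyReg (x y : ℕ) : Prog := .arith .add x y Reg.zero

/-- Leaves `base ^ key` modulo `modulus` in `acc`, by repeated squaring. -/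
def powProg : Prog :=
  .arith .mod Reg.base Reg.base Reg.modulus ;;
  .const Reg.acc 1 ;;
  copyReg Reg.counter Reg.key ;;
  .loop Reg.counter powStep ;;
  .arith .mod Reg.acc Reg.acc Reg.modulus

variable {k M t : ℕ} {s : Store}

/-- The invariant of repeated squaring modulo `M`, where the powers are congruent to `t`. -/
structure PowInv (M t : ℕ) (s : Store) : Prop where
  two : s Reg.two = 2
  modulus : s Reg.modulus = M
  -- Remainders modulo `0` would not be bounded, hence the loop must not run.
  counter : M = 0 → s Reg.counter = 0
  congr : s Reg.acc * s Reg.base ^ s Reg.counter ≡ t [MOD M]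

theorem powStep_congr {a x e : ℕ} :
    (if e % 2 = 0 then a else a * x) % M * (x * x % M) ^ (e / 2) ≡ a * x ^ e [MOD M] := by
  have hx : (x * x % M) ^ (e / 2) ≡ x ^ (2 * (e / 2)) [MOD M] := by
    rw [pow_mul, pow_two]
    exact (Nat.mod_modEq _ _).pow _
  refine ((Nat.mod_modEq _ _).mul hx).trans ?_
  rcases Nat.mod_two_eq_zero_or_one e with he | he
  · rw [if_pos he, show 2 * (e / 2) = e by omega]
  · rw [if_neg (by omega), mul_assoc, ← pow_succ', show 2 * (e / 2) + 1 = e by omega]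

theorem yields_powStep (hs : PowInv M t s) (hcounter : s Reg.counter ≠ 0) :
    Yields k powStep s powStep.timeBound (PMF.pure ()) fun _ s' =>
      PowInv M t s' ∧ s' Reg.counter = s Reg.counter / 2 ∧
        ∀ S, s.SizeLE S → s'.SizeLE (S + 1) := by
  have hM : 0 < M := Nat.pos_of_ne_zero fun h => hcounter (hs.counter h)
  have hres : powStep.result s = Function.update (Function.update (Function.update
      (Function.update s Reg.flag (s Reg.counter % 2)) Reg.acc
        ((if s Reg.counter % 2 = 0 then s Reg.acc else s Reg.acc * s Reg.base) % M))
      Reg.base (s Reg.base * s Reg.base % M)) Reg.counter (s Reg.counter / 2) := by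
    have htwo := hs.two
    have hmodulus := hs.modulus
    rcases Nat.mod_two_eq_zero_or_one (s Reg.counter) with h | h <;>
      simp [powStep, Prog.result, ArithOp.apply, h, htwo, hmodulus]
  refine .straight rfl ?_
  rw [hres]
  refine ⟨⟨?_, ?_, ?_, ?_⟩, ?_, fun S hS => ?_⟩
  · simpa using hs.two
  · simpa using hs.modulus
  · exact fun h => (hM.ne' h).elim
  · simpa using powStep_congr.trans hs.congr
  · simp
  · have hmod : ∀ x, (x % M).size ≤ S + 1 := fun x =>
      (Nat.size_le_size (Nat.mod_lt x hM).le).trans (hs.modulus ▸ hS.succ Reg.modulus)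
    refine .update (.update (.update (.update hS.succ _ ?_) _ (hmod _)) _ (hmod _)) _
      ((Nat.size_le_size (Nat.div_le_self _ _)).trans (hS.succ _))
    rcases Nat.mod_two_eq_zero_or_one (s Reg.counter) with h | h <;> simp [h]

theorem yields_powProg (hzero : s Reg.zero = 0) (htwo : s Reg.two = 2)
    (hmodulus : s Reg.modulus = s Reg.key * s Reg.key) :
    Yields k powProg s powProg.timeBound (PMF.pure ()) fun _ s' =>
      s' Reg.acc = s Reg.base ^ s Reg.key % (s Reg.key * s Reg.key) := by
  have hstart : PowInv (s Reg.key * s Reg.key) (s Reg.base ^ s Reg.key)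
      ((copyReg Reg.counter Reg.key).result ((Prog.const Reg.acc 1).result
        ((Prog.arith .mod Reg.base Reg.base Reg.modulus).result s))) := by
    constructor
    · simpa [copyReg, Prog.result] using htwo
    · simpa [copyReg, Prog.result] using hmodulus
    · simp [copyReg, Prog.result, ArithOp.apply, hzero]
    · simpa [copyReg, Prog.result, ArithOp.apply, hzero, hmodulus]
        using (Nat.mod_modEq _ _).pow _
  refine .straight_seq rfl (.straight_seq rfl (.straight_seq rfl ?_))
  rw [← iterBind_pure]
  refine (Yields.loop (Inv := fun _ => PowInv _ _) (fun _ _ => yields_powStep)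
    hstart).seq_straight rfl fun _ s' h => ?_
  obtain ⟨hinv, hcounter⟩ := h
  have hcongr := hinv.congr
  have hmodulus' := hinv.modulus
  rw [hcounter, pow_zero, mul_one] at hcongr
  simpa [Prog.result, ArithOp.apply, hmodulus', Nat.ModEq] using hcongr

end Power

/-! ### The query of the reduction -/

section Iid

/-- The distribution of `n` independent values. -/
noncomputable def iid {α : Type*} (d : PMF α) : (n : ℕ) → PMF (Fin n → α)
  | 0 => PMF.pure Fin.elim0
  | n + 1 => (iid d n).bind fun r => d.map fun a => Fin.snoc r a

end Iid

section Query

/-- The entry at `i + 1` of the query for `w`, with `z` at `w` and an encryption of zero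
elsewhere. -/
def queryEntry (N w z i r : ℕ) : ℕ :=
  if i + 1 = w then z else r ^ N % (N * N)

/-- The query for `w` with `z` at `w` and encryptions of zero with randomness distributed as `U`
elsewhere. -/
noncomputable def queryDist (n N w z : ℕ) (U : PMF ℕ) : PMF (Fin n → ℕ) :=
  (iid U n).map fun r i => queryEntry N w z i (r i)

/-- Stores the entry at `i + 1` of the query. Subtraction of registers is truncated, so that `flag`
becomes the distance of `i + 1` and `index`. -/
def storeEntry (i : ℕ) : Prog :=
  .const Reg.flag (i + 1) ;;
  .arith .sub Reg.scratch Reg.flag Reg.index ;;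
  .arith .sub Reg.flag Reg.index Reg.flag ;;
  .arith .add Reg.flag Reg.flag Reg.scratch ;;
  .ite Reg.flag (copyReg (Reg.guess (i + 3)) Reg.acc) (copyReg (Reg.guess (i + 3)) Reg.entry)

def entryProg (i : ℕ) : Prog := randomBitsProg ;; powProg ;; storeEntry i

/-- Writes the query to the registers of the second phase, after its three other inputs. -/
def queryProg : ℕ → Prog
  | 0 => .const Reg.flag 0
  | n + 1 => queryProg n ;; entryProg n

/-- The registers are ready for the construction of the query for `w` with entry `z` at `w`. -/
structure QueryReady (N w z : ℕ) (s : Store) : Prop where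
  key : s Reg.key = N
  index : s Reg.index = w
  entry : s Reg.entry = z
  modulus : s Reg.modulus = N * N
  zero : s Reg.zero = 0
  two : s Reg.two = 2

variable {k N w z i : ℕ} {s s' : Store}

theorem QueryReady.of_frame (h : QueryReady N w z s) {P : Prog} (hP : ∀ x ∈ P.writes, 10 < x)
    (hs' : ∀ x ∉ P.writes, s' x = s x) : QueryReady N w z s' := by
  have hs' : ∀ x ≤ 10, s' x = s x := fun x hx => hs' x fun hw => (hP x hw).not_ge hx
  constructor <;> rw [hs' _ (by decide)]
  exacts [h.key, h.index, h.entry, h.modulus, h.zero, h.two]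

theorem writes_entryProg : (entryProg i).writes ⊆ insert (Reg.guess (i + 3)) (Set.Icc 11 15) := by
  simp [entryProg, randomBitsProg, bitStep, powProg, powStep, storeEntry, copyReg, Prog.writes,
    Set.subset_def]

theorem writes_queryProg (n : ℕ) : (queryProg n).writes ⊆
    Set.Icc 11 15 ∪ {x | ∃ i < n, x = Reg.guess (i + 3)} := by
  induction n with
  | zero => simp [queryProg, Prog.writes]
  | succ n ih =>
    refine Set.union_subset (fun x hx => (ih hx).imp_right ?_) fun x hx => ?_
    · exact fun ⟨i, hi, hx⟩ => ⟨i, by omega, hx⟩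
    · exact (writes_entryProg hx).symm.imp_right fun h => ⟨n, n.lt_succ_self, h⟩

theorem result_storeEntry (hs : QueryReady N w z s) {r : ℕ} (hacc : s Reg.acc = r ^ N % (N * N)) :
    (storeEntry i).result s (Reg.guess (i + 3)) = queryEntry N w z i r := by
  have hindex := hs.index
  have hzero := hs.zero
  have hentry := hs.entry
  have hflag : w ≤ i + 1 ∧ i < w ↔ i + 1 = w := by omega
  simp [storeEntry, copyReg, Prog.result, ArithOp.apply, queryEntry, hindex, hzero, hentry, hacc,
    Nat.sub_eq_zero_iff_le, hflag]

theorem yields_entryProg (hs : QueryReady N w z s) :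
    Yields k (entryProg i) s (entryProg i).timeBound (randomBits (N * N).size 0) fun r s' =>
      s' (Reg.guess (i + 3)) = queryEntry N w z i r := by
  have hbits := (yields_randomBitsProg (k := k) hs.two).frame
  rw [hs.key] at hbits
  rw [← PMF.bind_pure (randomBits _ _)]
  refine hbits.seq fun r s₁ h₁ => ?_
  have hs₁ := hs.of_frame (by simp [randomBitsProg, bitStep, Prog.writes]) h₁.2
  have hpow := (yields_powProg (k := k) hs₁.zero hs₁.two (by rw [hs₁.modulus, hs₁.key])).frame
  rw [h₁.1, hs₁.key] at hpow
  refine hpow.seq_pure fun s₂ h₂ => ?_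
  have hs₂ := hs₁.of_frame (by simp [powProg, powStep, copyReg, Prog.writes]) h₂.2
  exact .straight rfl (result_storeEntry hs₂ h₂.1)

theorem yields_queryProg (hs : QueryReady N w z s) (n : ℕ) :
    Yields k (queryProg n) s (queryProg n).timeBound (iid (randomBits (N * N).size 0) n)
      fun r s' => ∀ i : Fin n, s' (Reg.guess (i + 3)) = queryEntry N w z i (r i) := by
  induction n with
  | zero => exact .straight rfl fun i => i.elim0
  | succ n ih =>
    refine ih.frame.seq fun r s₁ h₁ => ?_
    have hs₁ := hs.of_frame (fun x hx => by
      rcases writes_queryProg n hx with hx | ⟨i, -, rfl⟩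
      · exact hx.1
      · simp) h₁.2
    refine (yields_entryProg hs₁).frame.map _ fun a s₂ h₂ => Fin.lastCases ?_ fun i => ?_
    · simpa only [Fin.snoc_last, Fin.val_last] using h₂.1
    · rw [Fin.snoc_castSucc, Fin.val_castSucc, ← h₁.1 i]
      have := i.isLt
      refine h₂.2 _ fun hw => ?_
      rcases writes_entryProg hw with h | ⟨-, h⟩ <;> simp only [Reg.guess] at h <;> omega

end Query

/-! ### The reduction -/

section Reduction

theorem Reg.propose_injective : Function.Injective Reg.propose := fun i j h => by
  simp only [Reg.propose] at h
  omega

theorem Reg.guess_injective : Function.Injective Reg.guess := fun i j h => by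
  simp only [Reg.guess] at h
  omega

/-- Loads the constants and the input of the first phase. -/
def proposeInit : Prog :=
  .const Reg.one 1 ;;
  .const Reg.two 2 ;;
  .arith .mul Reg.modulus Reg.key Reg.key ;;
  copyReg (Reg.propose 0) Reg.secParam ;;
  copyReg (Reg.propose 1) Reg.key

/-- Chooses the index, computes the entry at it, and loads the input of the second phase without
the query. -/
def guessInit : Prog :=
  .ite Reg.indexCoin (copyReg Reg.index (Reg.propose 1)) (copyReg Reg.index (Reg.propose 0)) ;;
  .arith .mul Reg.entry Reg.plainCoin Reg.key ;;
  .arith .add Reg.entry Reg.entry Reg.one ;;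
  .arith .mul Reg.entry Reg.entry Reg.challenge ;;
  .arith .mod Reg.entry Reg.entry Reg.modulus ;;
  copyReg (Reg.guess 0) Reg.secParam ;;
  copyReg (Reg.guess 1) Reg.key ;;
  copyReg (Reg.guess 2) (Reg.propose 2)

/-- Leaves `1` in `verdict` if the correctness of the guess agrees with `plainCoin`, and `0`
otherwise. -/
def verdictProg : Prog :=
  .ite (Reg.guess 0)
    (.ite Reg.indexCoin (copyReg Reg.verdict Reg.plainCoin)
      (.arith .sub Reg.verdict Reg.one Reg.plainCoin))
    (.ite Reg.indexCoin (.arith .sub Reg.verdict Reg.one Reg.plainCoin)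
      (copyReg Reg.verdict Reg.plainCoin))

/-- The registers before and after the first phase of the responder, whose own registers hold
`r`. -/
structure ProposeReady (k N y : ℕ) (r s : Store) : Prop where
  secParam : s Reg.secParam = k
  key : s Reg.key = N
  challenge : s Reg.challenge = y
  modulus : s Reg.modulus = N * N
  zero : s Reg.zero = 0
  one : s Reg.one = 1
  two : s Reg.two = 2
  guess : ∀ i, s (Reg.guess i) = 0
  propose : ∀ i, s (Reg.propose i) = r i

/-- The registers before and after the second phase of the responder, whose own registers hold
`r`; the coins for the index and the plaintext are `b` and `c`. -/
structure GuessReady (b c : Bool) (r s : Store) : Prop where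
  zero : s Reg.zero = 0
  one : s Reg.one = 1
  indexCoin : s Reg.indexCoin = b.toNat
  plainCoin : s Reg.plainCoin = c.toNat
  guess : ∀ i, s (Reg.guess i) = r i

variable {k N y : ℕ} {b c : Bool} {r r' s s' : Store}

theorem result_proposeInit (k : ℕ) (v : Fin 2 → ℕ) :
    ProposeReady k (v 0) (v 1) (loadStore k ![v 0]) (proposeInit.result (loadStore k v)) := by
  constructor
  case propose =>
    rintro (_ | _ | i)
    · simp [proposeInit, copyReg, Prog.result, ArithOp.apply, loadStore]
    · simp [proposeInit, copyReg, Prog.result, ArithOp.apply, loadStore]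
    · simp [proposeInit, copyReg, Prog.result, ArithOp.apply, loadStore]
  case guess =>
    intro i
    simp [proposeInit, copyReg, Prog.result, ArithOp.apply, loadStore]
  all_goals simp [proposeInit, copyReg, Prog.result, ArithOp.apply, loadStore]

theorem ProposeReady.of_frame (h : ProposeReady k N y r s)
    (hs : ∀ i ∉ Set.range Reg.propose, s' i = s i) (hr : ∀ i, s' (Reg.propose i) = r' i) :
    ProposeReady k N y r' s' := by
  have hlt : ∀ i < 16, s' i = s i := fun i hi => hs i fun ⟨j, hj⟩ => by
    simp only [Reg.propose] at hj
    omega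
  refine ⟨?_, ?_, ?_, ?_, ?_, ?_, ?_, fun i => (hs _ fun ⟨j, hj⟩ => ?_).trans (h.guess i), hr⟩
  · rw [hlt _ (by decide), h.secParam]
  · rw [hlt _ (by decide), h.key]
  · rw [hlt _ (by decide), h.challenge]
  · rw [hlt _ (by decide), h.modulus]
  · rw [hlt _ (by decide), h.zero]
  · rw [hlt _ (by decide), h.one]
  · rw [hlt _ (by decide), h.two]
  · simp only [Reg.propose, Reg.guess] at hj
    omega

theorem GuessReady.of_frame (h : GuessReady b c r s) (hs : ∀ i < 11, s' i = s i)
    (hr : ∀ i, s' (Reg.guess i) = r' i) : GuessReady b c r' s' := by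
  refine ⟨?_, ?_, ?_, ?_, hr⟩
  · rw [hs _ (by decide), h.zero]
  · rw [hs _ (by decide), h.one]
  · rw [hs _ (by decide), h.indexCoin]
  · rw [hs _ (by decide), h.plainCoin]

theorem result_guessInit (hs : ProposeReady k N y r s) (hb : s Reg.indexCoin = b.toNat)
    (hc : s Reg.plainCoin = c.toNat) :
    QueryReady N (if b then r 1 else r 0) ((c.toNat * N + 1) * y % (N * N))
        (guessInit.result s) ∧
      GuessReady b c (loadStore k ![N, r 2]) (guessInit.result s) := by
  have hr : s 16 = r 0 ∧ s 18 = r 1 ∧ s 20 = r 2 := ⟨hs.propose 0, hs.propose 1, hs.propose 2⟩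
  obtain ⟨hk, hkey, hchallenge, hmodulus, hzero, hone, htwo, hguess, -⟩ := hs
  constructor
  · constructor
    all_goals cases b <;> simp [guessInit, copyReg, Prog.result, ArithOp.apply, *]
  · constructor
    case guess =>
      rintro (_ | _ | _ | i)
      case succ.succ.succ =>
        have hi : s (2 * (i + 1 + 1 + 1) + 17) = 0 := hguess (i + 3)
        have hne : 2 * (i + 1 + 1 + 1) ≠ 4 := by omega
        cases b <;>
          simp [guessInit, copyReg, Prog.result, loadStore, Function.update_apply, hi, hne]
      all_goals simp [guessInit, copyReg, Prog.result, ArithOp.apply, loadStore, *]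
    all_goals simp [guessInit, copyReg, Prog.result, ArithOp.apply, *]

theorem result_verdictProg (hs : GuessReady b c r s) :
    decide (verdictProg.result s Reg.verdict = 1) = ((decide (r 0 ≠ 0) == b) == c) := by
  have hguess := hs.guess 0
  obtain ⟨hzero, hone, hb, hc, -⟩ := hs
  rcases eq_or_ne (r 0) 0 with h | h <;> cases b <;> cases c <;>
    simp [verdictProg, copyReg, Prog.result, ArithOp.apply, *]

theorem ProposeReady.update_coins (hs : ProposeReady k N y r s) (m₁ m₂ : ℕ) :
    ProposeReady k N y r
      (Function.update (Function.update s Reg.indexCoin m₁) Reg.plainCoin m₂) := by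
  obtain ⟨hk, hkey, hchallenge, hmodulus, hzero, hone, htwo, hguess, hpropose⟩ := hs
  constructor <;> simp [*]

theorem GuessReady.of_queryProg {w n : ℕ} {x : Fin n → ℕ}
    (hs : GuessReady b c (loadStore k ![N, w]) s)
    (hx : ∀ i : Fin n, s' (Reg.guess (i + 3)) = x i)
    (hs' : ∀ i ∉ (queryProg n).writes, s' i = s i) :
    GuessReady b c (loadStore k (Matrix.vecCons N (Matrix.vecCons w x))) s' := by
  have hlt : ∀ i < 11, s' i = s i := fun i hi => hs' i fun hw => by
    rcases writes_queryProg n hw with hw | ⟨j, -, rfl⟩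
    · exact hi.not_ge hw.1
    · simp only [Reg.guess] at hi
      omega
  have hguess : ∀ i, (∀ j < n, i ≠ j + 3) → s' (Reg.guess i) = s (Reg.guess i) := fun i hi =>
    hs' _ fun hw => by
      rcases writes_queryProg n hw with hw | ⟨j, hj, hij⟩
      · simp only [Reg.guess, Set.mem_Icc] at hw
        omega
      · exact hi j hj (Reg.guess_injective hij)
  refine hs.of_frame hlt ?_
  rintro (_ | _ | _ | i)
  · simpa [loadStore] using (hguess 0 (by omega)).trans (hs.guess 0)
  · simpa [loadStore] using (hguess 1 (by omega)).trans (hs.guess 1)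
  · simpa [loadStore] using (hguess 2 (by omega)).trans (hs.guess 2)
  · by_cases hi : i < n
    · simpa [loadStore, hi] using hx ⟨i, hi⟩
    · simpa [loadStore, hi] using (hguess (i + 3) (by omega)).trans (hs.guess (i + 3))

end Reduction

section Responder

variable {n : ℕ} (A : Responder n)

/-- The part of the distinguisher after the coins have been tossed. -/
def guessPhaseProg : Prog :=
  guessInit ;; queryProg n ;; A.guess.prog.rename Reg.guess ;; verdictProg

noncomputable def guessPhaseTime : ℕ[X] :=
  seqTime guessInit.timeBound (seqTime (queryProg n).timeBound
    (seqTime A.guess.callTime verdictProg.timeBound))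

/-- Whether the responder, whose first phase has left `r`, guesses the index `b` from the query
`x`. -/
noncomputable def guessesIndex (k N : ℕ) (r : Store) (b : Bool) (x : Fin n → ℕ) : PMF Bool :=
  (A.guess.exec k (Matrix.vecCons N (Matrix.vecCons (r 2) x))).map fun s => decide (s 0 ≠ 0) == b

/-- The verdict of the reduction after the first phase of the responder has left `r`, with coins
`b` for the index and `c` for the plaintext and randomness distributed as `U` for the encryptions
of zero. -/
noncomputable def verdict (U : PMF ℕ) (k N y : ℕ) (r : Store) (b c : Bool) : PMF Bool :=
  ((queryDist n N (if b then r 1 else r 0) ((c.toNat * N + 1) * y % (N * N)) U).bind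
    (guessesIndex A k N r b)).map (· == c)

theorem yields_guessPhaseProg {k N y : ℕ} {b c : Bool} {r s : Store} (hs : ProposeReady k N y r s)
    (hb : s Reg.indexCoin = b.toNat) (hc : s Reg.plainCoin = c.toNat) :
    Yields k (guessPhaseProg A) s (guessPhaseTime A)
      (verdict A (randomBits (N * N).size 0) k N y r b c)
      fun a s' => decide (s' Reg.verdict = 1) = a := by
  obtain ⟨hquery, hguess⟩ := result_guessInit hs hb hc
  rw [verdict, queryDist, PMF.bind_map, PMF.map_bind]
  refine .straight_seq rfl ((yields_queryProg hquery n).frame.seq fun u s₁ h₁ => ?_)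
  have hs₁ := hguess.of_queryProg h₁.1 h₁.2
  rw [Function.comp_apply, guessesIndex, PMF.map_comp, Function.comp_def]
  refine ((Yields.call A.guess Reg.guess_injective hs₁.guess).seq_straight rfl
    (R := fun s₂ s' => decide (s' Reg.verdict = 1) = ((decide (s₂ 0 ≠ 0) == b) == c))
    fun s₂ s' h₂ => ?_).map _ fun _ _ h => h
  refine result_verdictProg (hs₁.of_frame (fun i hi => h₂.2 i fun ⟨j, hj⟩ => ?_) h₂.1)
  simp only [Reg.guess] at hj
  omega

/-- The program of the distinguisher. -/
def reductionProg : Prog :=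
  proposeInit ;; A.propose.prog.rename Reg.propose ;; .coin Reg.indexCoin ;; .coin Reg.plainCoin ;;
    guessPhaseProg A

noncomputable def reductionTime : ℕ[X] :=
  seqTime proposeInit.timeBound (seqTime A.propose.callTime
    (seqTime 1 (seqTime 1 (guessPhaseTime A))))

/-- The verdict of the reduction on the public key `N` and the challenge `y`, with randomness
distributed as `U` for the encryptions of zero. -/
noncomputable def reductionDist (U : PMF ℕ) (k N y : ℕ) : PMF Bool :=
  (A.propose.exec k ![N]).bind fun r =>
  (PMF.uniformOfFintype Bool).bind fun b =>
  (PMF.uniformOfFintype Bool).bind fun c => verdict A U k N y r b c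

theorem yields_reductionProg (k : ℕ) (v : Fin 2 → ℕ) :
    Yields k (reductionProg A) (loadStore k v) (reductionTime A)
      (reductionDist A (randomBits (v 0 * v 0).size 0) k (v 0) (v 1))
      fun a s => decide (s Reg.verdict = 1) = a := by
  have hs := result_proposeInit k v
  refine .straight_seq rfl ((Yields.call A.propose Reg.propose_injective hs.propose).seq
    fun r s₁ h₁ => ?_)
  have hs₁ := hs.of_frame h₁.2 h₁.1
  refine Yields.coin.seq fun b s₂ h₂ => Yields.coin.seq fun c s₃ h₃ => ?_
  subst h₂ h₃
  exact yields_guessPhaseProg A (hs₁.update_coins _ _) (by simp) (by simp)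

/-- The distinguisher that runs the responder on a query with the challenge `y`, or with
`(N + 1) y`, at the chosen index. -/
noncomputable def reduction : PPT 2 := .ofYields (yields_reductionProg A)

theorem map_exec_reduction (k N y : ℕ) :
    ((reduction A).exec k ![N, y]).map (fun s => decide (s 0 = 1)) =
      reductionDist A (randomBits (N * N).size 0) k N y :=
  PPT.map_exec_ofYields (yields_reductionProg A) (fun _ _ _ _ h => h) k ![N, y]

end Responder

/-! ### Uniform distributions and independent samples -/

section Uniform

open scoped ENNReal

variable {α β : Type*}

theorem map_uniformOfFinset_apply [DecidableEq β] {s : Finset α} (hs : s.Nonempty) (f : α → β)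
    (y : β) : (PMF.uniformOfFinset s hs).map f y = (s.filter (f · = y)).card / s.card := by
  classical
  rw [← PMF.toOuterMeasure_apply_singleton, PMF.toOuterMeasure_map_apply,
    PMF.toOuterMeasure_uniformOfFinset_apply]
  congr

theorem map_uniformOfFinset_of_card_fiber [DecidableEq β] {s : Finset α} {t : Finset β}
    (hs : s.Nonempty) (ht : t.Nonempty) {f : α → β} {m : ℕ} (hf : ∀ x ∈ s, f x ∈ t)
    (hm : ∀ y ∈ t, (s.filter (f · = y)).card = m) :
    (PMF.uniformOfFinset s hs).map f = PMF.uniformOfFinset t ht := by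
  have hcard : s.card = m * t.card := by
    rw [Finset.card_eq_sum_card_fiberwise hf, Finset.sum_congr rfl hm, Finset.sum_const,
      smul_eq_mul, mul_comm]
  have hm₀ : m ≠ 0 := fun h => hs.card_ne_zero (by rw [hcard, h, zero_mul])
  ext y
  rw [map_uniformOfFinset_apply]
  by_cases hy : y ∈ t
  · rw [PMF.uniformOfFinset_apply_of_mem ht hy, hm y hy, hcard, Nat.cast_mul,
      ENNReal.div_eq_inv_mul, ENNReal.mul_inv (by simp) (by simp), mul_right_comm,
      ENNReal.inv_mul_cancel (by exact_mod_cast hm₀) (by simp), one_mul]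
  · have hempty : s.filter (f · = y) = ∅ :=
      Finset.filter_eq_empty_iff.2 fun x hx h => hy (h ▸ hf x hx)
    rw [PMF.uniformOfFinset_apply_of_notMem ht hy, hempty, Finset.card_empty, Nat.cast_zero,
      ENNReal.zero_div]

theorem iid_apply (d : PMF α) (n : ℕ) (r : Fin n → α) : iid d n r = ∏ i, d (r i) := by
  induction n with
  | zero => simp [iid, Subsingleton.elim r Fin.elim0]
  | succ n ih =>
    rw [iid, PMF.bind_apply, tsum_eq_single (Fin.init r), PMF.map_apply,
      tsum_eq_single (r (Fin.last n)), Fin.snoc_init_self, if_pos rfl, ih, Fin.prod_univ_castSucc]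
    · rfl
    · exact fun a ha => if_neg fun h => ha (by rw [h, Fin.snoc_last])
    · refine fun u hu => mul_eq_zero_of_right _ ?_
      rw [PMF.map_apply, ENNReal.tsum_eq_zero]
      exact fun a => if_neg fun h => hu (by rw [h, Fin.init_snoc])

theorem iid_uniformOfFinset {t : Finset α} (ht : t.Nonempty) (n : ℕ) :
    iid (PMF.uniformOfFinset t ht) n = PMF.uniformOfFinset (Fintype.piFinset fun _ : Fin n => t)
      (Fintype.piFinset_nonempty.2 fun _ => ht) := by
  ext r
  rw [iid_apply]
  by_cases hr : r ∈ Fintype.piFinset fun _ : Fin n => t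
  · rw [PMF.uniformOfFinset_apply_of_mem _ hr, Fintype.card_piFinset_const, Nat.cast_pow,
      Finset.prod_congr rfl fun i _ =>
        PMF.uniformOfFinset_apply_of_mem ht (Fintype.mem_piFinset.1 hr i),
      Finset.prod_const, Finset.card_univ, Fintype.card_fin, ENNReal.inv_pow]
  · obtain ⟨i, hi⟩ := not_forall.1 (mt Fintype.mem_piFinset.2 hr)
    rw [PMF.uniformOfFinset_apply_of_notMem _ hr]
    exact Finset.prod_eq_zero (Finset.mem_univ i) (PMF.uniformOfFinset_apply_of_notMem ht hi)

theorem iid_map (d : PMF α) (f : α → β) (n : ℕ) :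
    iid (d.map f) n = (iid d n).map fun r i => f (r i) := by
  induction n with
  | zero => rw [iid, iid, PMF.pure_map, Subsingleton.elim Fin.elim0 fun i => f (Fin.elim0 i)]
  | succ n ih =>
    simp only [iid, ih, PMF.map_bind, PMF.bind_map, PMF.map_comp, Function.comp_def]
    refine congrArg _ (funext fun r => congrArg (d.map ·) (funext fun a => funext fun i => ?_))
    refine Fin.lastCases ?_ (fun j => ?_) i <;> simp only [Fin.snoc_last, Fin.snoc_castSucc]

theorem bind_iid_map_ite (d : PMF α) (n w : ℕ) :
    (d.bind fun z => (iid d n).map fun r (i : Fin n) => if (i : ℕ) + 1 = w then z else r i) =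
      iid d n := by
  induction n with
  | zero =>
    have hmap : ∀ z : α, ((iid d 0).map fun r i => if ((i : Fin 0) : ℕ) + 1 = w then z else r i) =
        iid d 0 := fun z => by
      rw [iid, PMF.pure_map, Subsingleton.elim (fun _ => _) Fin.elim0]
    simp only [hmap, PMF.bind_const]
  | succ n ih =>
    have hsnoc : ∀ (z : α) (r : Fin n → α), (fun (a : α) (i : Fin (n + 1)) =>
        if (i : ℕ) + 1 = w then z else (Fin.snoc r a : Fin (n + 1) → α) i) =
          fun a => (Fin.snoc (fun i : Fin n => if (i : ℕ) + 1 = w then z else r i)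
            (if n + 1 = w then z else a) : Fin (n + 1) → α) := fun z r => by
      ext a i
      refine Fin.lastCases ?_ (fun j => ?_) i <;>
        simp only [Fin.snoc_last, Fin.snoc_castSucc, Fin.val_last, Fin.val_castSucc]
    simp only [iid, PMF.map_bind, PMF.map_comp, Function.comp_def, hsnoc]
    by_cases hw : n + 1 = w
    · have hne : ∀ i : Fin n, (i : ℕ) + 1 ≠ w := fun i => by omega
      have hconst : ∀ (z : α) (r : Fin n → α), (d.map fun _ => (Fin.snoc r z : Fin (n + 1) → α)) =
          PMF.pure (Fin.snoc r z) := fun z r => d.map_const _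
      simp only [hw, hne, if_true, if_false, hconst]
      exact PMF.bind_comm _ _ _
    · simp only [hw, if_false]
      conv_rhs => rw [← ih]
      simp only [PMF.bind_bind, PMF.bind_map, Function.comp_def]

end Uniform

/-! ### Statistical distance -/

section StatDist

open scoped ENNReal

variable {α β : Type*}

/-- The statistical distance of two distributions, as the total mass by which `p` exceeds `q`
(the subtraction is truncated at zero). -/
noncomputable def statDist (p q : PMF α) : ℝ≥0∞ := ∑' a, (p a - q a)

variable {p q r : PMF α} {δ : ℝ≥0∞}

theorem tsum_sub_tsum_le (f g : α → ℝ≥0∞) : ∑' a, f a - ∑' a, g a ≤ ∑' a, (f a - g a) := by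
  rw [tsub_le_iff_right, ← ENNReal.tsum_add]
  exact ENNReal.tsum_le_tsum fun a => le_tsub_add

theorem statDist_comm (p q : PMF α) : statDist p q = statDist q p := by
  have hmax : ∀ p q : PMF α, statDist p q + 1 = ∑' a, max (p a) (q a) := fun p q => by
    rw [statDist, ← q.tsum_coe, ← ENNReal.tsum_add]
    exact tsum_congr fun a => tsub_add_eq_max
  refine (ENNReal.add_left_inj ENNReal.one_ne_top).1 ?_
  simp only [hmax, max_comm]

theorem statDist_triangle (p q r : PMF α) : statDist p r ≤ statDist p q + statDist q r := by
  rw [statDist, statDist, statDist, ← ENNReal.tsum_add]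
  exact ENNReal.tsum_le_tsum fun a => tsub_le_tsub_add_tsub

theorem statDist_bind_le_left (p q : PMF α) (f : α → PMF β) :
    statDist (p.bind f) (q.bind f) ≤ statDist p q := by
  calc
    statDist (p.bind f) (q.bind f) ≤ ∑' b, ∑' a, (p a - q a) * f a b :=
      ENNReal.tsum_le_tsum fun b => (tsum_sub_tsum_le _ _).trans_eq <| tsum_congr fun a =>
        (ENNReal.sub_mul fun _ _ => (f a).apply_ne_top b).symm
    _ = ∑' a, (p a - q a) * ∑' b, f a b := by
      rw [ENNReal.tsum_comm]
      simp only [ENNReal.tsum_mul_left]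
    _ = statDist p q := by simp only [PMF.tsum_coe, mul_one, statDist]

theorem statDist_bind_le_right (p : PMF α) {f g : α → PMF β}
    (h : ∀ a ∈ p.support, statDist (f a) (g a) ≤ δ) : statDist (p.bind f) (p.bind g) ≤ δ := by
  calc
    statDist (p.bind f) (p.bind g) ≤ ∑' b, ∑' a, p a * (f a b - g a b) :=
      ENNReal.tsum_le_tsum fun b => (tsum_sub_tsum_le _ _).trans_eq <| tsum_congr fun a =>
        (ENNReal.mul_sub fun _ _ => p.apply_ne_top a).symm
    _ = ∑' a, p a * statDist (f a) (g a) := by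
      rw [ENNReal.tsum_comm]
      simp only [ENNReal.tsum_mul_left, statDist]
    _ ≤ ∑' a, p a * δ := ENNReal.tsum_le_tsum fun a => by
      by_cases ha : p a = 0
      · simp only [ha, zero_mul, le_refl]
      · exact mul_le_mul_right (h a ((p.mem_support_iff a).2 ha)) _
    _ = δ := by rw [ENNReal.tsum_mul_right, p.tsum_coe, one_mul]

theorem statDist_map_le (p q : PMF α) (f : α → β) : statDist (p.map f) (q.map f) ≤ statDist p q :=
  statDist_bind_le_left p q _

theorem statDist_iid_le (p q : PMF α) (n : ℕ) :
    statDist (iid p n) (iid q n) ≤ n * statDist p q := by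
  induction n with
  | zero => simp only [iid, statDist, tsub_self, tsum_zero, zero_le]
  | succ n ih =>
    rw [iid, iid, Nat.cast_succ, add_one_mul]
    refine (statDist_triangle _ _ _).trans (add_le_add ((statDist_bind_le_left _ _ _).trans ih) ?_)
    exact statDist_bind_le_right _ fun r _ => statDist_map_le p q _

theorem abs_toReal_apply_sub_le {δ : ℝ} (hδ : 0 ≤ δ) (h : statDist p q ≤ ENNReal.ofReal δ) (a : α) :
    |(p a).toReal - (q a).toReal| ≤ δ := by
  have hle : ∀ p q : PMF α, statDist p q ≤ ENNReal.ofReal δ →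
      (p a).toReal ≤ (q a).toReal + δ := fun p q h => by
    rw [← ENNReal.toReal_ofReal hδ, ← ENNReal.toReal_add (q.apply_ne_top a) ENNReal.ofReal_ne_top]
    refine ENNReal.toReal_mono (ENNReal.add_ne_top.2 ⟨q.apply_ne_top a, ENNReal.ofReal_ne_top⟩) ?_
    exact tsub_le_iff_left.1 ((ENNReal.le_tsum a).trans h)
  rw [abs_sub_le_iff]
  exact ⟨by linarith [hle p q h], by linarith [hle q p (statDist_comm p q ▸ h)]⟩

theorem statDist_uniformOfFinset_le {t : Finset α} (ht : t.Nonempty) {p : PMF α} {c : ℝ≥0∞}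
    (hc : ∀ a ∈ t, c ≤ p a) : statDist (PMF.uniformOfFinset t ht) p ≤ 1 - t.card * c := by
  have hcard : (t.card : ℝ≥0∞) ≠ 0 := Nat.cast_ne_zero.2 ht.card_ne_zero
  calc
    statDist (PMF.uniformOfFinset t ht) p = ∑ a ∈ t, ((t.card : ℝ≥0∞)⁻¹ - p a) := by
      rw [statDist, tsum_eq_sum (s := t) fun a ha => by
        rw [PMF.uniformOfFinset_apply_of_notMem ht ha, zero_tsub]]
      exact Finset.sum_congr rfl fun a ha => by rw [PMF.uniformOfFinset_apply_of_mem ht ha]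
    _ ≤ ∑ _a ∈ t, ((t.card : ℝ≥0∞)⁻¹ - c) :=
      Finset.sum_le_sum fun a ha => tsub_le_tsub_left (hc a ha) _
    _ = 1 - t.card * c := by
      rw [Finset.sum_const, nsmul_eq_mul, ENNReal.mul_sub fun _ _ => ENNReal.natCast_ne_top _,
        ENNReal.mul_inv_cancel hcard (ENNReal.natCast_ne_top _)]

end StatDist

/-! ### Residues -/

section Residues

variable {M N : ℕ}

/-- A uniformly distributed element of `ℤ_M^*`; for `M = N` this is the randomness of an
encryption. -/
noncomputable def uniformUnit (hM : M ≠ 0) : PMF ℕ :=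
  PMF.uniformOfFinset (unitResidues M) (unitResidues_nonempty hM)

theorem mem_unitResidues {x : ℕ} : x ∈ unitResidues M ↔ x < M ∧ x.Coprime M := by
  rw [unitResidues, Finset.mem_filter, Finset.mem_range]

theorem card_unitResidues (M : ℕ) : (unitResidues M).card = M.totient := by
  simp only [unitResidues, Nat.totient, Nat.coprime_comm]

theorem mod_coprime_iff {x : ℕ} : (x % M).Coprime M ↔ x.Coprime M := by
  rw [Nat.Coprime, Nat.Coprime, ← Nat.gcd_rec, Nat.gcd_comm]

theorem map_mod_uniformUnit (hM : M ≠ 0) (e : ℕ) :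
    (uniformUnit (pow_ne_zero (e + 1) hM)).map (· % M) = uniformUnit hM := by
  have hpos : 0 < M := Nat.pos_of_ne_zero hM
  refine map_uniformOfFinset_of_card_fiber _ _ (m := M ^ e) (fun x hx => ?_) fun y hy => ?_
  · rw [mem_unitResidues, Nat.coprime_pow_right_iff e.succ_pos] at hx
    exact mem_unitResidues.2 ⟨Nat.mod_lt _ hpos, mod_coprime_iff.2 hx.2⟩
  · obtain ⟨hy, hyM⟩ := mem_unitResidues.1 hy
    conv_rhs => rw [← Finset.card_range (M ^ e)]
    refine Finset.card_nbij' (· / M) (y + M * ·) (fun x hx => ?_) (fun j hj => ?_)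
      (fun x hx => ?_) fun j _ => ?_
    · simp only [Finset.coe_filter, Set.mem_ofPred_eq, mem_unitResidues, pow_succ'] at hx
      exact Finset.mem_coe.2 (Finset.mem_range.2 (Nat.div_lt_of_lt_mul hx.1.1))
    · have hlt : y + M * j < M ^ (e + 1) := by
        have hj : M * (j + 1) ≤ M * M ^ e := Nat.mul_le_mul_left M (by simpa using hj)
        rw [pow_succ']
        linarith
      simpa [mem_unitResidues, hlt, Nat.coprime_pow_right_iff e.succ_pos, Nat.mod_eq_of_lt hy]
        using hyM
    · simp only [Finset.coe_filter, Set.mem_ofPred_eq] at hx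
      simp only [← hx.2, Nat.mod_add_div]
    · simp only [Nat.add_mul_div_left _ _ hpos, Nat.div_eq_of_lt hy, zero_add]

theorem map_mul_mod_uniformUnit (hM : M ≠ 0) {a : ℕ} (ha : a.Coprime M) :
    (uniformUnit hM).map (fun y => a * y % M) = uniformUnit hM := by
  have hmaps : Set.MapsTo (fun y => a * y % M) (unitResidues M) (unitResidues M) := fun x hx =>
    mem_unitResidues.2 ⟨Nat.mod_lt _ (Nat.pos_of_ne_zero hM),
      mod_coprime_iff.2 (ha.mul_left (mem_unitResidues.1 hx).2)⟩
  have hinj : Set.InjOn (fun y => a * y % M) (unitResidues M) := fun x hx y hy h =>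
    (Nat.ModEq.cancel_left_of_coprime ha.symm h).eq_of_lt_of_lt (mem_unitResidues.1 hx).1
      (mem_unitResidues.1 hy).1
  refine map_uniformOfFinset_of_card_fiber _ _ (m := 1) hmaps fun y hy => ?_
  obtain ⟨x, hx, hxy⟩ := Finset.surjOn_of_injOn_of_card_le _ hmaps hinj le_rfl hy
  refine Finset.card_eq_one.2 ⟨x, Finset.eq_singleton_iff_unique_mem.2 ⟨?_, fun x' hx' => ?_⟩⟩
  · exact Finset.mem_filter.2 ⟨hx, hxy⟩
  · obtain ⟨hx', h⟩ := Finset.mem_filter.1 hx'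
    exact hinj hx' hx (h.trans hxy.symm)

theorem mod_pow_self_modEq (r N : ℕ) : (r % N) ^ N ≡ r ^ N [MOD N ^ 2] := by
  have hdvd : (N : ℤ) ∣ r - (r % N : ℕ) := Nat.modEq_iff_dvd.1 (Nat.mod_modEq r N)
  rw [Nat.modEq_iff_dvd]
  simpa only [pow_one, one_add_one_eq_two, Nat.cast_pow] using dvd_sub_pow_of_dvd_sub hdvd 1

end Residues

section Sampling

open scoped ENNReal

theorem randomBits_apply (m a x : ℕ) :
    randomBits m a x = if x / 2 ^ m = a then ((2 : ℝ≥0∞) ^ m)⁻¹ else 0 := by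
  induction m generalizing a with
  | zero => simp [randomBits, iterBind]
  | succ m ih =>
    have hstep : randomBits (m + 1) a =
        (PMF.uniformOfFintype Bool).bind fun b => randomBits m (2 * a + b.toNat) := by
      rw [randomBits, iterBind, PMF.bind_map]
      rfl
    have hdiv : x / 2 ^ (m + 1) = a ↔ x / 2 ^ m = 2 * a + 1 ∨ x / 2 ^ m = 2 * a := by
      rw [pow_succ, ← Nat.div_div_eq_div_mul]
      omega
    have hpow : ((2 : ℝ≥0∞) ^ (m + 1))⁻¹ = 2⁻¹ * (2 ^ m)⁻¹ := by
      rw [pow_succ', ENNReal.mul_inv (by simp) (by simp)]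
    rw [hstep, PMF.bind_apply, tsum_fintype, Fintype.sum_bool]
    simp only [ih, PMF.uniformOfFintype_apply, Fintype.card_bool, Bool.toNat_true,
      Bool.toNat_false, hdiv, hpow]
    by_cases h : x / 2 ^ m = 2 * a + 1
    · simp [h]
    · simp [h]

theorem le_map_mod_randomBits {m N x : ℕ} (hx : x < N) :
    ((2 ^ m / N : ℕ) : ℝ≥0∞) * (2 ^ m)⁻¹ ≤ (randomBits m 0).map (· % N) x := by
  have hN : 0 < N := Nat.zero_lt_of_lt hx
  have hinj : Set.InjOn (fun j => x + N * j) (Finset.range (2 ^ m / N)) := fun i _ j _ h =>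
    Nat.eq_of_mul_eq_mul_left hN (Nat.add_left_cancel h)
  have hval : ∀ j ∈ Finset.range (2 ^ m / N), randomBits m 0 (x + N * j) = (2 ^ m)⁻¹ := by
    intro j hj
    have hj : N * (j + 1) ≤ 2 ^ m :=
      (Nat.mul_le_mul_left N (Finset.mem_range.1 hj)).trans (Nat.mul_div_le _ _)
    rw [randomBits_apply, if_pos (Nat.div_eq_of_lt (by linarith))]
  have hmod : ∀ j, x = (x + N * j) % N := fun j => by
    rw [Nat.add_mul_mod_self_left, Nat.mod_eq_of_lt hx]
  rw [PMF.map_apply]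
  refine le_trans (le_of_eq ?_) (ENNReal.sum_le_tsum
    ((Finset.range (2 ^ m / N)).image fun j => x + N * j))
  rw [Finset.sum_image hinj]
  refine (Eq.trans (Finset.sum_congr rfl fun j hj => (if_pos (hmod j)).trans (hval j hj)) ?_).symm
  rw [Finset.sum_const, Finset.card_range, nsmul_eq_mul]

variable {p q k : ℕ}

theorem le_totient_mul_of_prime (hp : p.Prime) (hq : q.Prime) (hpk : 2 ^ k ≤ p) (hqk : 2 ^ k ≤ q) :
    (1 - 2 / 2 ^ k : ℝ) * (p * q : ℕ) ≤ (p * q).totient := by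
  have hsub : ∀ {r : ℕ}, 2 ^ k ≤ r → r.Prime → (1 - 1 / 2 ^ k) * (r : ℝ) ≤ (r - 1 : ℕ) :=
    fun {r} hrk hr => by
      have hrk : (2 : ℝ) ^ k ≤ r := by exact_mod_cast hrk
      have h1 : 1 ≤ 1 / 2 ^ k * (r : ℝ) := by
        rwa [div_mul_eq_mul_div, one_mul, one_le_div (by positivity)]
      rw [Nat.cast_sub hr.one_le, Nat.cast_one]
      linarith
  have hk : (0 : ℝ) ≤ 1 - 1 / 2 ^ k :=
    sub_nonneg.2 (div_le_one_of_le₀ (one_le_pow₀ one_le_two) (by positivity))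
  calc
    (1 - 2 / 2 ^ k : ℝ) * (p * q : ℕ) ≤ (1 - 1 / 2 ^ k) ^ 2 * (p * q : ℕ) := by
      gcongr
      linarith [sq_nonneg (1 / 2 ^ k : ℝ), show (2 : ℝ) / 2 ^ k = 2 * (1 / 2 ^ k) by ring]
    _ = (1 - 1 / 2 ^ k) * p * ((1 - 1 / 2 ^ k) * q) := by
      push_cast
      ring
    _ ≤ (p - 1 : ℕ) * (q - 1 : ℕ) := by
      gcongr
      exacts [hsub hpk hp, hsub hqk hq]
    _ ≤ (p * q).totient := by
      have h := Nat.totient_super_multiplicative p q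
      rw [Nat.totient_prime hp, Nat.totient_prime hq] at h
      exact_mod_cast h

theorem le_totient_mul_div {M N : ℕ} (hM : N * N ≤ M) (hkN : 2 ^ k ≤ N)
    (hN : (1 - 2 / 2 ^ k : ℝ) * N ≤ N.totient) :
    (1 - 3 / 2 ^ k : ℝ) ≤ N.totient * ((M / N : ℕ) * (M : ℝ)⁻¹) := by
  have hNpos : 0 < N := (Nat.two_pow_pos k).trans_le hkN
  have hMpos : 0 < M := (Nat.mul_pos hNpos hNpos).trans_le hM
  have hN₀ : (0 : ℝ) < N := by exact_mod_cast hNpos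
  have hM₀ : (0 : ℝ) < M := by exact_mod_cast hMpos
  have htotient : (N.totient : ℝ) ≤ N := by exact_mod_cast N.totient_le
  have hdiv : (M : ℝ) / N - 1 ≤ (M / N : ℕ) := by
    have h := Nat.lt_mul_div_succ M hNpos
    rw [sub_le_iff_le_add, div_le_iff₀ hN₀, mul_comm]
    exact_mod_cast h.le
  have hsmall : (N : ℝ) / M ≤ 1 / 2 ^ k := by
    rw [div_le_div_iff₀ hM₀ (by positivity), one_mul]
    exact_mod_cast (Nat.mul_le_mul_left N hkN).trans hM
  calc
    (1 - 3 / 2 ^ k : ℝ) = 1 - 2 / 2 ^ k - 1 / 2 ^ k := by ring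
    _ ≤ N.totient / N - N.totient / M :=
      sub_le_sub ((le_div_iff₀ hN₀).2 hN)
        ((div_le_div_of_nonneg_right htotient hM₀.le).trans hsmall)
    _ = N.totient * ((M / N - 1) * (M : ℝ)⁻¹) := by field_simp
    _ ≤ N.totient * ((M / N : ℕ) * (M : ℝ)⁻¹) := by gcongr

theorem statDist_map_mod_randomBits_le {K : PaillierKey} (hp : 2 ^ k ≤ K.p) (hq : 2 ^ k ≤ K.q) :
    statDist ((randomBits (K.N * K.N).size 0).map (· % K.N)) (uniformUnit K.N_ne_zero) ≤
      ENNReal.ofReal (3 / 2 ^ k) := by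
  have hN : 2 ^ k ≤ K.N := hp.trans (Nat.le_mul_of_pos_right _ K.prime_q.pos)
  have h := le_totient_mul_div (Nat.lt_size_self (K.N * K.N)).le hN
    (le_totient_mul_of_prime K.prime_p K.prime_q hp hq)
  rw [statDist_comm]
  refine (statDist_uniformOfFinset_le _ fun a ha =>
    le_map_mod_randomBits (mem_unitResidues.1 ha).1).trans ?_
  rw [card_unitResidues, tsub_le_iff_right]
  have h' := ENNReal.ofReal_le_ofReal (sub_le_iff_le_add'.1 h)
  rw [ENNReal.ofReal_one, ENNReal.ofReal_add (by positivity) (by positivity),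
    ENNReal.ofReal_mul (by positivity), ENNReal.ofReal_mul (by positivity),
    ENNReal.ofReal_inv_of_pos (by positivity)] at h'
  simp only [ENNReal.ofReal_natCast] at h'
  exact_mod_cast h'

end Sampling

/-! ### The games -/

section Games

open scoped ENNReal

theorem map_beq_uniformOfFintype (o : Bool) :
    (PMF.uniformOfFintype Bool).map (o == ·) = PMF.uniformOfFintype Bool := by
  ext x
  rw [PMF.map_apply, tsum_fintype, Fintype.sum_bool]
  cases o <;> cases x <;> simp

theorem uniformOfFintype_bind_map_beq (p : PMF Bool) :
    ((PMF.uniformOfFintype Bool).bind fun c => p.map (· == c)) = PMF.uniformOfFintype Bool := by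
  rw [show (fun c => p.map (· == c)) = fun c => p.bind fun o => PMF.pure (o == c) from rfl,
    PMF.bind_comm]
  exact (congrArg p.bind (funext map_beq_uniformOfFintype)).trans (PMF.bind_const _ _)

/-- The query for `w` whose entry at `w` encrypts `t` and whose other entries encrypt `0`. -/
noncomputable def plaintextQuery (n : ℕ) (K : PaillierKey) (w t : ℕ) : PMF (Fin n → ℕ) :=
  (iid (uniformUnit K.N_ne_zero) n).map fun r i =>
    paillierEncrypt K.N (if (i : ℕ) + 1 = w then t else 0) (r i)

theorem plaintextQuery_one (n : ℕ) (K : PaillierKey) (w : ℕ) :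
    plaintextQuery n K w 1 = submitQuery n K w := by
  rw [plaintextQuery, uniformUnit, iid_uniformOfFinset]
  rfl

theorem plaintextQuery_zero (n : ℕ) (K : PaillierKey) (w : ℕ) :
    plaintextQuery n K w 0 = plaintextQuery n K 0 0 := by
  simp only [plaintextQuery, ite_self]

theorem randomResidue_eq_map_uniformUnit (K : PaillierKey) :
    randomResidue K = (uniformUnit K.N_ne_zero).map fun r => r ^ K.N % K.N ^ 2 := by
  rw [← map_mod_uniformUnit K.N_ne_zero 1, PMF.map_comp]
  exact congrArg (fun f => PMF.map f (randomUnit K))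
    (funext fun r => (mod_pow_self_modEq r K.N).symm)

theorem randomResidue_bind_queryDist (n : ℕ) (K : PaillierKey) (w : ℕ) (c : Bool) :
    ((randomResidue K).bind fun y => queryDist n K.N w ((c.toNat * K.N + 1) * y % (K.N * K.N))
      (uniformUnit K.N_ne_zero)) = plaintextQuery n K w c.toNat := by
  have hpow : (K.N + 1) ^ c.toNat = c.toNat * K.N + 1 := by cases c <;> simp
  have hentry : (fun (z : ℕ) (r : Fin n → ℕ) (i : Fin n) => queryEntry K.N w
      ((c.toNat * K.N + 1) * (z ^ K.N % K.N ^ 2) % (K.N * K.N)) i (r i)) =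
      fun (z : ℕ) (r : Fin n → ℕ) (i : Fin n) => paillierEncrypt K.N
        (if (i : ℕ) + 1 = w then c.toNat else 0)
        (if (i : ℕ) + 1 = w then z else r i) := by
    funext z r i
    rw [queryEntry, paillierEncrypt, ← pow_two]
    split_ifs
    · rw [hpow, Nat.mul_mod_mod]
    · rw [pow_zero, one_mul]
  rw [plaintextQuery, ← bind_iid_map_ite (uniformUnit K.N_ne_zero) n w, PMF.map_bind,
    randomResidue_eq_map_uniformUnit, PMF.bind_map]
  simp only [PMF.map_comp]
  refine congrArg _ (funext fun z => ?_)
  exact congrArg (fun f => PMF.map f (iid (uniformUnit K.N_ne_zero) n)) (congrFun hentry z)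

theorem randomUnit_bind_queryDist (n : ℕ) (K : PaillierKey) (w : ℕ) (c : Bool) (U : PMF ℕ) :
    ((randomUnit K).bind fun y => queryDist n K.N w ((c.toNat * K.N + 1) * y % (K.N * K.N)) U) =
      (randomUnit K).bind fun z => queryDist n K.N w z U := by
  have hcop : (c.toNat * K.N + 1).Coprime (K.N ^ 2) := Nat.Coprime.pow_right 2 (by simp)
  have hmap := map_mul_mod_uniformUnit (pow_ne_zero 2 K.N_ne_zero) hcop
  change _ = (uniformUnit (pow_ne_zero 2 K.N_ne_zero)).bind fun z => queryDist n K.N w z U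
  rw [← pow_two, ← hmap, PMF.bind_map]
  rfl

theorem statDist_queryDist_le {k : ℕ} {K : PaillierKey} (hp : 2 ^ k ≤ K.p) (hq : 2 ^ k ≤ K.q)
    (n w z : ℕ) :
    statDist (queryDist n K.N w z (randomBits (K.N * K.N).size 0))
      (queryDist n K.N w z (uniformUnit K.N_ne_zero)) ≤ ENNReal.ofReal (n * (3 / 2 ^ k)) := by
  have hmod (U : PMF ℕ) : queryDist n K.N w z U = queryDist n K.N w z (U.map (· % K.N)) := by
    rw [queryDist, queryDist, iid_map, PMF.map_comp]
    refine congrArg (fun f => PMF.map f (iid U n)) (funext fun r => funext fun i => ?_)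
    have h := mod_pow_self_modEq (r i) K.N
    rw [Nat.ModEq, pow_two] at h
    simp only [Function.comp_apply, queryEntry, h]
  rw [hmod, queryDist, queryDist, ENNReal.ofReal_mul n.cast_nonneg, ENNReal.ofReal_natCast]
  exact (statDist_map_le _ _ _).trans ((statDist_iid_le _ _ n).trans
    (mul_le_mul_right (statDist_map_mod_randomBits_le hp hq) _))

variable {n : ℕ} (A : Responder n)

theorem bind_reductionDist (X U : PMF ℕ) (k N : ℕ) :
    X.bind (reductionDist A U k N) =
      (A.propose.exec k ![N]).bind fun r =>
      (PMF.uniformOfFintype Bool).bind fun b =>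
      (PMF.uniformOfFintype Bool).bind fun c =>
      ((X.bind fun y => queryDist n N (if b then r 1 else r 0)
        ((c.toNat * N + 1) * y % (N * N)) U).bind (guessesIndex A k N r b)).map (· == c) := by
  unfold reductionDist verdict
  simp only [PMF.bind_comm X, PMF.bind_bind, PMF.map_bind]

theorem randomUnit_bind_reductionDist (U : PMF ℕ) (k : ℕ) (K : PaillierKey) :
    (randomUnit K).bind (reductionDist A U k K.N) = PMF.uniformOfFintype Bool := by
  simp only [bind_reductionDist, randomUnit_bind_queryDist, uniformOfFintype_bind_map_beq,
    PMF.bind_const]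

/-- The security experiment for a fixed key. -/
noncomputable def keyExperiment (k : ℕ) (K : PaillierKey) : PMF Bool :=
  (A.propose.exec k ![K.N]).bind fun r =>
  (PMF.uniformOfFintype Bool).bind fun b =>
  (submitQuery n K (if b then r 1 else r 0)).bind (guessesIndex A k K.N r b)

variable {A} in
theorem guessExperiment_eq_bind_keyExperiment {G : KeyGen} (hA : A.Admissible G) (k : ℕ) :
    guessExperiment G A k = (G.dist k).bind (keyExperiment A k) := by
  refine bind_congr_of_support fun K hK => bind_congr_of_support fun r hr => ?_
  obtain ⟨-, -, hne⟩ := hA k K hK r hr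
  refine congrArg (PMF.bind _) (funext fun b => congrArg (PMF.bind _) (funext fun x => ?_))
  refine congrArg (fun f => PMF.map f _) (funext fun s => ?_)
  by_cases h : s 0 = 0 <;> cases b <;> simp [h, hne, hne.symm]

theorem randomResidue_bind_reductionDist (k : ℕ) (K : PaillierKey) :
    (randomResidue K).bind (reductionDist A (uniformUnit K.N_ne_zero) k K.N) =
      (PMF.uniformOfFintype Bool).bind fun c =>
        if c then keyExperiment A k K else PMF.uniformOfFintype Bool := by
  rw [bind_reductionDist]
  simp only [randomResidue_bind_queryDist]
  refine (congrArg _ (funext fun r => PMF.bind_comm _ _ _)).trans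
    ((PMF.bind_comm _ _ _).trans (congrArg _ (funext fun c => ?_)))
  cases c
  · have hcoin (r : Store) : ((PMF.uniformOfFintype Bool).bind fun b =>
        ((plaintextQuery n K 0 0).bind (guessesIndex A k K.N r b)).map (· == false)) =
        PMF.uniformOfFintype Bool := by
      refine Eq.trans (congrArg _ (funext fun b => ?_)) (uniformOfFintype_bind_map_beq
        ((plaintextQuery n K 0 0).bind (guessesIndex A k K.N r false)))
      rw [PMF.map_bind, PMF.map_bind]
      refine congrArg _ (funext fun x => ?_)
      rw [guessesIndex, guessesIndex, PMF.map_comp, PMF.map_comp]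
      exact congrArg (fun f => PMF.map f _) (funext fun s => by cases b <;> simp)
    simp only [Bool.toNat_false, plaintextQuery_zero, hcoin, PMF.bind_const, Bool.false_eq_true,
      if_false]
  · simp only [Bool.toNat_true, plaintextQuery_one, beq_true, if_true, keyExperiment]
    refine congrArg _ (funext fun r => congrArg _ (funext fun b => PMF.map_id _))

/-- The probability that the reduction accepts a challenge drawn from `X` if its own encryptions
use uniform randomness. -/
noncomputable def idealAcceptProb (G : KeyGen) (X : PaillierKey → PMF ℕ) (k : ℕ) : ℝ :=
  (((G.dist k).bind fun K => (X K).bind (reductionDist A (uniformUnit K.N_ne_zero) k K.N))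
    true).toReal

theorem idealAcceptProb_randomUnit (G : KeyGen) (k : ℕ) :
    idealAcceptProb A G randomUnit k = 1 / 2 := by
  simp [idealAcceptProb, randomUnit_bind_reductionDist]

variable {A} in
theorem idealAcceptProb_randomResidue {G : KeyGen} (hA : A.Admissible G) (k : ℕ) :
    idealAcceptProb A G randomResidue k = ((guessExperiment G A k true).toReal + 1 / 2) / 2 := by
  have hsplit : ((G.dist k).bind fun K =>
      (randomResidue K).bind (reductionDist A (uniformUnit K.N_ne_zero) k K.N)) true =
      2⁻¹ * guessExperiment G A k true + 2⁻¹ * 2⁻¹ := by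
    simp only [randomResidue_bind_reductionDist]
    rw [PMF.bind_comm, PMF.bind_apply, tsum_fintype, Fintype.sum_bool,
      guessExperiment_eq_bind_keyExperiment hA]
    simp
  rw [idealAcceptProb, hsplit, ENNReal.toReal_add
    (ENNReal.mul_ne_top (by simp) (PMF.apply_ne_top _ _)) (by simp [ENNReal.mul_eq_top])]
  simp only [ENNReal.toReal_mul, ENNReal.toReal_inv, ENNReal.toReal_ofNat]
  ring

theorem abs_acceptProb_sub_idealAcceptProb_le (G : KeyGen) (X : PaillierKey → PMF ℕ) (k : ℕ) :
    |acceptProb G X (reduction A) k - idealAcceptProb A G X k| ≤ n * (3 / 2 ^ k) := by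
  refine abs_toReal_apply_sub_le (by positivity) ?_ true
  refine statDist_bind_le_right _ fun K hK => statDist_bind_le_right _ fun y _ => ?_
  obtain ⟨hp, hq⟩ := G.large k K hK
  rw [map_exec_reduction]
  refine statDist_bind_le_right _ fun r _ => statDist_bind_le_right _ fun b _ =>
    statDist_bind_le_right _ fun c _ => ?_
  exact (statDist_map_le _ _ _).trans
    ((statDist_bind_le_left _ _ _).trans (statDist_queryDist_le hp hq n _ _))

variable {A} in
theorem advantage_le {G : KeyGen} (hA : A.Admissible G) (k : ℕ) :
    advantage G A k ≤ 2 * |acceptProb G randomResidue (reduction A) k -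
      acceptProb G randomUnit (reduction A) k| + 12 * n * (1 / 2 ^ k) := by
  have hresidue := abs_acceptProb_sub_idealAcceptProb_le A G randomResidue k
  have hunit := abs_acceptProb_sub_idealAcceptProb_le A G randomUnit k
  rw [idealAcceptProb_randomResidue hA, abs_sub_comm] at hresidue
  rw [idealAcceptProb_randomUnit] at hunit
  set a := acceptProb G randomResidue (reduction A) k
  set b := acceptProb G randomUnit (reduction A) k
  set e := (guessExperiment G A k true).toReal with he
  calc
    advantage G A k = 2 * |((e + 1 / 2) / 2 - a) + (a - b) + (b - 1 / 2)| := by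
      rw [advantage, ← he, ← abs_two (α := ℝ), ← abs_mul, abs_two]
      ring_nf
    _ ≤ 2 * (n * (3 / 2 ^ k) + |a - b| + n * (3 / 2 ^ k)) := by
      gcongr
      exact (abs_add_three _ _ _).trans (by gcongr)
    _ = 2 * |a - b| + 12 * n * (1 / 2 ^ k) := by ring

end Games

/-! ### Negligible functions -/

theorem Negligible.mono {f g : ℕ → ℝ} (hg : Negligible g) (h : ∀ n, f n ≤ g n) : Negligible f :=
  fun c => (hg c).imp fun _ hn n hle => (h n).trans (hn n hle)

theorem Negligible.add {f g : ℕ → ℝ} (hf : Negligible f) (hg : Negligible g) :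
    Negligible fun n => f n + g n := by
  intro c
  obtain ⟨n₁, hf⟩ := hf (c + 1)
  obtain ⟨n₂, hg⟩ := hg (c + 1)
  refine ⟨max 2 (max n₁ n₂), fun n hn => ?_⟩
  have hn₂ : (2 : ℝ) ≤ n := by exact_mod_cast (le_max_left _ _).trans hn
  calc
    f n + g n ≤ 1 / n ^ (c + 1) + 1 / n ^ (c + 1) := add_le_add (hf n (by omega)) (hg n (by omega))
    _ = 2 / (n * n ^ c) := by rw [pow_succ']; ring
    _ ≤ n / (n * n ^ c) := by gcongr
    _ = 1 / n ^ c := by field_simp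

theorem Negligible.const_mul {f : ℕ → ℝ} (hf : Negligible f) (m : ℕ) :
    Negligible fun n => m * f n := by
  induction m with
  | zero => exact fun c => ⟨0, fun n _ => by simp⟩
  | succ m ih => exact (ih.add hf).mono fun n => by rw [Nat.cast_succ, add_one_mul]

theorem negligible_one_div_two_pow : Negligible fun n => 1 / 2 ^ n := by
  intro c
  have hlim := tendsto_pow_const_div_const_pow_of_one_lt c (one_lt_two (α := ℝ))
  obtain ⟨n₀, hn₀⟩ := Filter.eventually_atTop.1
    ((hlim.eventually_le_const one_pos).and (Filter.eventually_gt_atTop 0))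
  refine ⟨n₀, fun n hn => ?_⟩
  obtain ⟨hle, hpos⟩ := hn₀ n hn
  exact one_div_le_one_div_of_le (pow_pos (Nat.cast_pos.2 hpos) c)
    ((div_le_one (by positivity)).1 hle)

theorem proposition3 (n : ℕ) (G : KeyGen) (hG : DecisionalCompositeResiduosity G) :
    QuerySecure n G := by
  intro A hA
  have hsmall := ((hG (reduction A)).const_mul 2).add
    (negligible_one_div_two_pow.const_mul (12 * n))
  refine hsmall.mono fun k => ?_
  push_cast
  exact advantage_le hA k
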